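/- Let $\Delta$ be a simplicial complex on the vertex set $[n]=\{1,\dots,n\}$ and let $k$ be a field. For $T\subseteq[n]$ let $\Delta|_T$ be the restriction of $\Delta$ to $T$, i.e. the complex on the vertex set $T$ consisting of all faces of $\Delta$ contained in $T$, and let $k[\Delta|_T]=k[x_i : i\in T]/I_{\Delta|_T}$ be its Stanley–Reisner ring, where $I_{\Delta|_T}$ is generated by the squarefree monomials $\prod_{i\in\sigma}x_i$ with $\sigma\subseteq T$, $\sigma\notin\Delta$. Let $h$ be an integer and assume that $\Delta$ is a vertex minimal $h$-cycle over $k$, i.e. for every $T\subseteq[n]$ the reduced simplicial homology $\tilde H_h(\Delta|_T;k)$ is nonzero if and only if $T=[n]$. If $T\subseteq[n]$ is a set of vertices such that $\Delta|_T$ is disconnected, then $$\operatorname{reg}\bigl(k[\Delta|_{[n]\setminus T}]\bigr)\ \ge\ h .$$ Here $\operatorname{reg}(M)=\max\{j-i : \beta_{i,j}(M)\ne0\}$ is the Castelnuovo–Mumford regularity of a finitely generated graded module $M$ over a polynomial ring $S$, where the graded Betti number $\beta_{i,j}(M)$ is the exponent of $S(-j)$ in homological degree $i$ of a minimal graded free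 resolution of $M$. -/

import Mathlib

open MvPolynomial

/-! ### Simplicial complexes

Following Mathlib, the faces recorded in an `AbstractSimplicialComplex V` are the *nonempty* ones,
and every `v : V` is a vertex. -/

namespace AbstractSimplicialComplex

variable {V : Type*}

/-- `σ` is a face of `Δ`, where (as usual in combinatorial commutative algebra) the empty set is
counted as a face. -/
def IsFace (Δ : AbstractSimplicialComplex V) (σ : Finset V) : Prop :=
  σ = ∅ ∨ σ ∈ Δ

/-- The restriction `Δ|_T`: the complex on the vertex set `T` whose faces are the faces of `Δ`
contained in `T`. -/
def restrict (Δ : AbstractSimplicialComplex V) (T : Finset V) :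
    AbstractSimplicialComplex {v // v ∈ T} where
  faces := {σ | σ.map (Function.Embedding.subtype _) ∈ Δ}
  isRelLowerSet_faces := by
    intro σ hσ
    have h := Δ.isRelLowerSet_faces hσ
    refine ⟨by simpa using h.1, fun τ hτ hne => ?_⟩
    exact h.2 (Finset.map_subset_map.mpr hτ) (by simpa using hne)
  singleton_mem := by
    intro v
    have h : {v.1} ∈ Δ := Δ.singleton_mem v.1
    simpa using h

/-- The `1`-skeleton of `Δ`, as a simple graph on the vertices of `Δ`. -/
def oneSkeleton [DecidableEq V] (Δ : AbstractSimplicialComplex V) : SimpleGraph V where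
  Adj v w := v ≠ w ∧ ({v, w} : Finset V) ∈ Δ
  symm := ⟨fun v w h => ⟨h.1.symm, by simpa [Finset.pair_comm] using h.2⟩⟩
  loopless := ⟨fun _ h => h.1 rfl⟩

/-- `Δ` is disconnected: two of its vertices are not joined by any path of edges. (The complex
without vertices is not counted as disconnected.) -/
def IsDisconnected [DecidableEq V] (Δ : AbstractSimplicialComplex V) : Prop :=
  ¬ Δ.oneSkeleton.Preconnected

/-! ### Reduced simplicial homology -/

section Homology

variable (k : Type*) [Field k] [LinearOrder V] [Fintype V]

/-- The simplicial boundary map on the vector space with basis all subsets `σ` of `V` (a vector is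
given by its coordinates): `σ = {v₀ < ⋯ < v_d}` is sent to `∑ i, (-1)^i (σ \ {v_i})`. In particular
`{v}` is sent to `∅` (the augmentation) and `∅` is sent to `0`. -/
noncomputable def boundary (V : Type*) [LinearOrder V] [Fintype V] :
    (Finset V → k) →ₗ[k] (Finset V → k) :=
  Fintype.linearCombination k fun σ : Finset V =>
    ∑ v ∈ σ, Pi.single (σ.erase v) ((-1 : k) ^ (σ.filter (· < v)).card)

/-- The space of (augmented) simplicial `i`-chains of `Δ`, with basis the faces of dimension `i`,
that is, of cardinality `i + 1`; the empty face has dimension `-1`. -/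
def chains (Δ : AbstractSimplicialComplex V) (i : ℤ) : Submodule k (Finset V → k) where
  carrier := {c | ∀ σ, c σ ≠ 0 → Δ.IsFace σ ∧ (σ.card : ℤ) = i + 1}
  zero_mem' := fun σ h => (h rfl).elim
  add_mem' := by
    intro a b ha hb σ h
    by_cases h0 : a σ = 0
    · exact hb σ fun h1 => h (by simp [h0, h1])
    · exact ha σ h0
  smul_mem' := by
    intro r a ha σ h
    exact ha σ fun h0 => h (by simp [h0])

/-- The `i`-cycles of the augmented chain complex of `Δ`. -/
noncomputable def cycles (Δ : AbstractSimplicialComplex V) (i : ℤ) : Submodule k (Finset V → k) :=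
  Δ.chains k i ⊓ LinearMap.ker (boundary k V)

/-- The `i`-boundaries of the augmented chain complex of `Δ`. -/
noncomputable def boundaries (Δ : AbstractSimplicialComplex V) (i : ℤ) :
    Submodule k (Finset V → k) :=
  (Δ.chains k (i + 1)).map (boundary k V)

/-- The `i`-th reduced simplicial homology of `Δ` with coefficients in `k`: cycles modulo
boundaries. -/
abbrev ReducedHomology (Δ : AbstractSimplicialComplex V) (i : ℤ) : Type _ :=
  (Δ.cycles k i) ⧸ (Δ.boundaries k i).submoduleOf (Δ.cycles k i)

/-- `Δ` is a vertex minimal `h`-cycle over `k`: the restriction of `Δ` to `T` has nonzero reduced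
homology in degree `h` if and only if `T` is the whole vertex set. -/
def IsVertexMinimalCycle (Δ : AbstractSimplicialComplex V) (h : ℤ) : Prop :=
  ∀ T : Finset V, Nontrivial ((Δ.restrict T).ReducedHomology k h) ↔ T = Finset.univ

end Homology

/-! ### The Stanley-Reisner ring -/

section StanleyReisner

variable (k : Type*) [Field k]

/-- The Stanley-Reisner ideal, generated by the squarefree monomials of the non-faces of `Δ`. -/
noncomputable def stanleyReisnerIdeal (Δ : AbstractSimplicialComplex V) :
    Ideal (MvPolynomial V k) :=
  Ideal.span {p | ∃ σ : Finset V, ¬ Δ.IsFace σ ∧ p = ∏ v ∈ σ, X v}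

/-- The Stanley-Reisner ring `k[Δ]`, a quotient of the polynomial ring whose variables are the
vertices of `Δ`. -/
abbrev StanleyReisnerRing (Δ : AbstractSimplicialComplex V) : Type _ :=
  MvPolynomial V k ⧸ Δ.stanleyReisnerIdeal k

/-- The degree `d` part of `k[Δ]`: the classes of the homogeneous polynomials of degree `d`. -/
noncomputable def stanleyReisnerGrading (Δ : AbstractSimplicialComplex V) (d : ℕ) :
    Submodule k (Δ.StanleyReisnerRing k) :=
  (homogeneousSubmodule V k d).map (Ideal.Quotient.mkₐ k (Δ.stanleyReisnerIdeal k)).toLinearMap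

end StanleyReisner

end AbstractSimplicialComplex

/-! ### Minimal graded free resolutions, graded Betti numbers, regularity -/

section Regularity

variable (k : Type*) [Field k] (V : Type*)

/-- The degree `d` part of the graded free module `⨁ g, S(-a g)` over `S = k[x_v : v ∈ V]`:
families `f` such that `f g` is homogeneous of degree `d - a g` for every `g` (and `f g = 0`
if `d < a g`). -/
def gradedFreePart {r : ℕ} (a : Fin r → ℕ) (d : ℕ) : Set (Fin r → MvPolynomial V k) :=
  {f | ∀ g, (a g ≤ d ∧ (f g).IsHomogeneous (d - a g)) ∨ (d < a g ∧ f g = 0)}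

/-- A minimal graded free resolution of finite length
`0 → F_s → ⋯ → F_1 → F_0 → M → 0` of a graded module `M = ⨁ d, ℳ d` over the polynomial ring
`S = k[x_v : v ∈ V]` with its standard grading. Here `F_i = ⨁ g, S(-shift i g)` is free of finite
rank `rank i`, all maps preserve degrees, and minimality means that the image of `F_{i+1} → F_i`
lies in `𝔪 F_i`, where `𝔪` is the ideal generated by the variables. -/
structure MinimalGradedFreeResolution (M : Type*) [AddCommGroup M] [Module k M]
    [Module (MvPolynomial V k) M] (ℳ : ℕ → Submodule k M) where
  rank : ℕ → ℕ
  shift : ∀ i, Fin (rank i) → ℕ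
  d : ∀ i, (Fin (rank (i + 1)) → MvPolynomial V k) →ₗ[MvPolynomial V k]
    (Fin (rank i) → MvPolynomial V k)
  aug : (Fin (rank 0) → MvPolynomial V k) →ₗ[MvPolynomial V k] M
  d_graded : ∀ i e, ∀ f ∈ gradedFreePart k V (shift (i + 1)) e,
    d i f ∈ gradedFreePart k V (shift i) e
  aug_graded : ∀ e, ∀ f ∈ gradedFreePart k V (shift 0) e, aug f ∈ ℳ e
  aug_surjective : Function.Surjective aug
  exact_zero : Function.Exact (d 0) aug
  exact_succ : ∀ i, Function.Exact (d (i + 1)) (d i)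
  finite_length : ∃ s, ∀ i, s < i → rank i = 0
  minimal : ∀ i f g, d i f g ∈ Ideal.span (Set.range (X : V → MvPolynomial V k))

/-- The exponent `β_{i,j}` of `S(-j)` in the `i`-th module of a minimal graded free resolution. -/
def MinimalGradedFreeResolution.betti {k : Type*} [Field k] {V : Type*} {M : Type*}
    [AddCommGroup M] [Module k M] [Module (MvPolynomial V k) M] {ℳ : ℕ → Submodule k M}
    (F : MinimalGradedFreeResolution k V M ℳ) (i j : ℕ) : ℕ :=
  (Finset.univ.filter fun g : Fin (F.rank i) => F.shift i g = j).card

variable {M : Type*} [AddCommGroup M] [Module k M] [Module (MvPolynomial V k) M]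

open Classical in
/-- The graded Betti number `β_{i,j}(M)` of a graded module `M = ⨁ d, ℳ d`, read off from a
minimal graded free resolution (and set to `0` if there is none). -/
noncomputable def gradedBetti (ℳ : ℕ → Submodule k M) (i j : ℕ) : ℕ :=
  if hF : Nonempty (MinimalGradedFreeResolution k V M ℳ) then hF.some.betti i j else 0

/-- The Castelnuovo-Mumford regularity of a graded module `M = ⨁ d, ℳ d`: the maximum of `j - i`
over all `i`, `j` with `β_{i,j}(M) ≠ 0`. It is taken in the extended reals so that nothing is said
by convention (only finitely many Betti numbers are nonzero; the value is `⊥` if all of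
them vanish). -/
noncomputable def regularity (ℳ : ℕ → Submodule k M) : EReal :=
  ⨆ (i : ℕ) (j : ℕ) (_ : gradedBetti k V ℳ i j ≠ 0), (((j : ℝ) - (i : ℝ) : ℝ) : EReal)

end Regularity

/-- The Castelnuovo-Mumford regularity of the Stanley-Reisner ring `k[Δ]`, as a graded module over
the polynomial ring on the vertices of `Δ`. -/
noncomputable def AbstractSimplicialComplex.stanleyReisnerRegularity {V : Type*} (k : Type*)
    [Field k] (Δ : AbstractSimplicialComplex V) : EReal :=
  regularity k V (Δ.stanleyReisnerGrading k)

/-! If `Δ|_T` is disconnected, `T` is a disjoint union of nonempty sets `A` and `B` such that no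
face of `Δ` meets both. Hence `Δ` is the union of `Δ|_{Aᶜ}` and `Δ|_{Bᶜ}`, which intersect in
`Δ|_{Tᶜ}`. By vertex minimality both pieces have no homology in degree `h`, so by Mayer–Vietoris the
nonzero `H_h(Δ)` embeds into `H_{h-1}(Δ|_{Tᶜ})` (`IsVertexMinimalCycle.nontrivial_of_separated`).

It remains to see that a complex on `m` vertices with nonzero reduced homology in degree `q - 1` has
regularity at least `q`. This is the part of Hochster's formula in multidegree `(1, …, 1)`: such
homology forces `β_{m-q,m} ≠ 0`. A functional that kills the boundaries but not a given cycle `z` is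
a cocycle. It yields a squarefree cycle in the Koszul complex over the Stanley–Reisner ring
(`koszul_koszulCochain_mem`), which is not a boundary because the functional is nonzero on `z`
(`apply_eq_zero_of_koszulCochain`). On the other hand, if the `p`-th module of the resolution had no
generator of degree `m = p + q`, dimension shifting along the resolution would make that Koszul
class zero (`koszulHomology_syzygy_eq_zero`).

Since `gradedBetti` is `0` when there is no minimal resolution, one has to be constructed
(`nonempty_minimalGradedFreeResolution`), with its finite length given by Hilbert's syzygy theorem
(`rank_eq_zero_of_minimal`). Both dimension shifts rest on the exactness of the Koszul complex of
the variables (`koszul_X_exact`). -/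

/-! ### The Koszul complex -/

section Koszul

/-- `c` is supported on the subsets of `V` with `p` elements. -/
def IsChainOfDegree {V M : Type*} [AddCommGroup M] (p : ℕ) (c : Finset V → M) : Prop :=
  ∀ A, c A ≠ 0 → A.card = p

variable {V : Type*} [LinearOrder V]

/-- The sign `(-1) ^ m`, where `m` is the number of elements of `A` below `v`. -/
def lowerSign (R : Type*) [CommRing R] (v : V) (A : Finset V) : R :=
  (-1) ^ (A.filter (· < v)).card

theorem lowerSign_mul_self (R : Type*) [CommRing R] (v : V) (A : Finset V) :
    lowerSign R v A * lowerSign R v A = 1 := by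
  rw [lowerSign, ← mul_pow]
  simp

theorem lowerSign_insert (R : Type*) [CommRing R] {v w : V} {A : Finset V} (hw : w ∉ A) :
    lowerSign R v (insert w A) = (if w < v then -1 else 1) * lowerSign R v A := by
  unfold lowerSign
  rw [Finset.filter_insert]
  split_ifs with h
  · rw [Finset.card_insert_of_notMem (by simp [hw]), pow_succ']
  · rw [one_mul]

/-- Of the two insertions, only that of the smaller element changes the sign attached to the other
one. -/
theorem lowerSign_anticomm (R : Type*) [CommRing R] {v w : V} {A : Finset V} (hv : v ∉ A)
    (hw : w ∉ A) (hvw : v ≠ w) :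
    lowerSign R v A * lowerSign R w (insert v A) =
      -(lowerSign R w A * lowerSign R v (insert w A)) := by
  rw [lowerSign_insert R hv, lowerSign_insert R hw]
  rcases lt_or_gt_of_ne hvw with h | h
  · simp [h, h.not_gt, mul_comm]
  · simp [h, h.not_gt, mul_comm]

variable [Fintype V] {R : Type*} [CommRing R] (x : V → R)
  {M : Type*} [AddCommGroup M] [Module R M] {N : Type*} [AddCommGroup N] [Module R N]

/-- The differential of the Koszul complex of the family `x` with coefficients in `M`. A chain is
given by its coordinates with respect to the basis of the exterior algebra indexed by the subsets
of `V`. -/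
def koszul : (Finset V → M) →ₗ[R] (Finset V → M) where
  toFun c A := ∑ v ∈ Aᶜ, (lowerSign R v A * x v) • c (insert v A)
  map_add' c c' := by
    ext A
    simp [Finset.sum_add_distrib]
  map_smul' r c := by
    ext A
    simp [Finset.smul_sum, smul_comm r]

theorem koszul_apply (c : Finset V → M) (A : Finset V) :
    koszul x c A = ∑ v ∈ Aᶜ, (lowerSign R v A * x v) • c (insert v A) := rfl

theorem koszul_koszul (c : Finset V → M) : koszul x (koszul x c) = 0 := by
  ext A
  simp only [koszul_apply, Finset.smul_sum, Pi.zero_apply, smul_smul]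
  rw [Finset.sum_sigma']
  refine Finset.sum_involution (fun p _ => ⟨p.2, p.1⟩) ?_ ?_ ?_ ?_
  · rintro ⟨v, w⟩ h
    simp only [Finset.mem_sigma, Finset.mem_compl, Finset.mem_insert, not_or] at h
    obtain ⟨hv, hwv, hw⟩ := h
    have h1 := lowerSign_anticomm R hv hw (Ne.symm hwv)
    simp only
    rw [Finset.insert_comm w v A, ← add_smul]
    have : lowerSign R v A * x v * (lowerSign R w (insert v A) * x w) +
        lowerSign R w A * x w * (lowerSign R v (insert w A) * x v) = 0 := by
      linear_combination (x v * x w) * h1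
    rw [this, zero_smul]
  · rintro ⟨v, w⟩ h _ h'
    simp only [Finset.mem_sigma, Finset.mem_compl, Finset.mem_insert, not_or] at h
    simp only [Sigma.mk.injEq, heq_eq_eq] at h'
    exact h.2.1 h'.1
  · rintro ⟨v, w⟩ h
    simp only [Finset.mem_sigma, Finset.mem_compl, Finset.mem_insert, not_or] at h ⊢
    exact ⟨h.2.2, Ne.symm h.2.1, h.1⟩
  · rintro ⟨v, w⟩ h
    rfl

theorem koszul_comp (φ : M →ₗ[R] N) (c : Finset V → M) :
    koszul x (fun A => φ (c A)) = fun A => φ (koszul x c A) := by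
  ext A
  simp [koszul_apply]

theorem isChainOfDegree_koszul {p : ℕ} {c : Finset V → M} (hc : IsChainOfDegree (p + 1) c) :
    IsChainOfDegree p (koszul x c) := by
  intro A hA
  obtain ⟨v, hv, h⟩ := Finset.exists_ne_zero_of_sum_ne_zero hA
  have h1 := hc (insert v A) fun h0 => h (by rw [h0, smul_zero])
  rw [Finset.card_insert_of_notMem (by simpa using hv)] at h1
  omega

/-- The differential lowers the degree by exactly one, so the component of `e` in degree `p + 1`
already has boundary `c`. -/
theorem IsChainOfDegree.exists_koszul_eq {p : ℕ} {c e : Finset V → M} (hc : IsChainOfDegree p c)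
    (he : koszul x e = c) : ∃ e' : Finset V → M, IsChainOfDegree (p + 1) e' ∧ koszul x e' = c := by
  refine ⟨fun A => if A.card = p + 1 then e A else 0, fun A hA => ?_, ?_⟩
  · by_contra h
    exact hA (if_neg h)
  · ext A
    rw [koszul_apply]
    by_cases hA : A.card = p
    · rw [← he, koszul_apply]
      refine Finset.sum_congr rfl fun v hv => ?_
      rw [Finset.card_insert_of_notMem (by simpa using hv), if_pos (by omega)]
    · rw [show c A = 0 by by_contra h; exact hA (hc A h)]
      refine Finset.sum_eq_zero fun v hv => ?_
      rw [Finset.card_insert_of_notMem (by simpa using hv), if_neg (by omega), smul_zero]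

end Koszul

/-! ### Exactness of the Koszul complex of the variables -/

section KoszulPolynomial

variable {V : Type*} [LinearOrder V] [Fintype V] {k : Type*} [Field k]

theorem mem_span_range_X_iff {V k : Type*} [Field k] (p : MvPolynomial V k) :
    p ∈ Ideal.span (Set.range (X : V → MvPolynomial V k)) ↔ coeff 0 p = 0 := by
  rw [← Set.image_univ, mem_ideal_span_X_image]
  constructor
  · intro h
    by_contra h0
    obtain ⟨i, -, hi⟩ := h 0 (by simpa using h0)
    exact hi rfl
  · intro h m hm
    have : m ≠ 0 := by
      rintro rfl
      simp [h] at hm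
    obtain ⟨i, hi⟩ := Finsupp.ne_iff.mp this
    exact ⟨i, trivial, hi⟩

/-- The quotient of the division by a variable, as an additive map. -/
noncomputable def divX {V : Type*} (k : Type*) [Field k] (v : V) :
    MvPolynomial V k →+ MvPolynomial V k where
  toFun f := f.divMonomial (Finsupp.single v 1)
  map_zero' := zero_divMonomial _
  map_add' f g := add_divMonomial f g _

theorem divX_X_mul {V k : Type*} [Field k] (v : V) (f : MvPolynomial V k) :
    divX k v (X v * f) = f :=
  X_mul_divMonomial v f

theorem X_mul_divX_add_modMonomial {V k : Type*} [Field k] (v : V) (f : MvPolynomial V k) :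
    X v * divX k v f + f.modMonomial (Finsupp.single v 1) = f :=
  divMonomial_add_modMonomial_single f v

theorem divX_lowerSign_mul {V k : Type*} [LinearOrder V] [Field k] {v w : V} (A : Finset V)
    (f : MvPolynomial V k) :
    divX k v (lowerSign (MvPolynomial V k) w A * f) =
      lowerSign (MvPolynomial V k) w A * divX k v f := by
  unfold lowerSign
  rcases neg_one_pow_eq_or (MvPolynomial V k) (A.filter (· < w)).card with h | h <;> rw [h] <;> simp

theorem divX_X_mul_of_ne {V k : Type*} [Field k] {v w : V} (h : w ≠ v) (f : MvPolynomial V k) :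
    divX k v (X w * f) = X w * divX k v f := by
  classical
  ext m
  change coeff m ((X w * f).divMonomial _) = coeff m (X w * f.divMonomial _)
  rw [coeff_divMonomial, coeff_X_mul', coeff_X_mul']
  have h1 : w ∈ (Finsupp.single v 1 + m).support ↔ w ∈ m.support := by
    simp [h.symm]
  simp only [h1]
  split_ifs with hw
  · rw [coeff_divMonomial]
    congr 1
    ext u
    simp only [Finsupp.coe_tsub, Finsupp.coe_add, Pi.sub_apply, Pi.add_apply, Finsupp.single_apply]
    by_cases hu : w = u
    · subst hu
      simp [h.symm]
    · simp [hu]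
  · rfl

/-- A Koszul cycle over the polynomial ring can be changed by a boundary such that the variable
`v` is eliminated. -/
theorem exists_koszul_eliminate (v : V) (c : Finset V → MvPolynomial V k)
    (hc : koszul (X : V → MvPolynomial V k) c = 0) : ∃ e : Finset V → MvPolynomial V k, ∀ A,
      (c - koszul (X : V → MvPolynomial V k) e) A =
        if v ∈ A then 0 else (c A).modMonomial (Finsupp.single v 1) := by
  -- The homotopy for one variable: divide by `X v` and multiply by the exterior generator of `v`.
  refine ⟨fun B => if v ∈ B then
    lowerSign (MvPolynomial V k) v (B.erase v) * divX k v (c (B.erase v))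
    else 0, fun A => ?_⟩
  rw [Pi.sub_apply, koszul_apply]
  split_ifs with hv
  -- The cycle condition at `A.erase v`, divided by `X v`, expresses `c A` through the coefficients
  -- that occur in the boundary of the chosen chain.
  · have hD := congrArg (divX k v) (congrFun hc (A.erase v))
    rw [koszul_apply, Finset.compl_erase, Finset.sum_insert (by simpa using hv), Pi.zero_apply,
      map_zero, map_add, map_sum, Finset.insert_erase hv, smul_eq_mul, mul_assoc,
      divX_lowerSign_mul, divX_X_mul] at hD
    have hs : lowerSign (MvPolynomial V k) v (A.erase v) * ∑ w ∈ Aᶜ,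
        divX k v ((lowerSign (MvPolynomial V k) w (A.erase v) * X w) •
          c (insert w (A.erase v))) = -∑ w ∈ Aᶜ, (lowerSign (MvPolynomial V k) w A * X w) •
        (lowerSign (MvPolynomial V k) v ((insert w A).erase v) *
          divX k v (c ((insert w A).erase v))) := by
      rw [Finset.mul_sum, ← Finset.sum_neg_distrib]
      refine Finset.sum_congr rfl fun w hw => ?_
      have hwA : w ∉ A := by simpa using hw
      have hwv : w ≠ v := fun h => hwA (h ▸ hv)
      have h1 := lowerSign_anticomm (MvPolynomial V k) (A := A.erase v) (v := v) (w := w)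
        (by simp) (by simp [hwA]) hwv.symm
      rw [Finset.insert_erase hv] at h1
      rw [smul_eq_mul, smul_eq_mul, mul_assoc, divX_lowerSign_mul, divX_X_mul_of_ne hwv,
        Finset.erase_insert_of_ne hwv]
      have h2 := lowerSign_mul_self (MvPolynomial V k) w A
      have h3 := lowerSign_mul_self (MvPolynomial V k) w (A.erase v)
      generalize lowerSign (MvPolynomial V k) v (A.erase v) = a at *
      generalize lowerSign (MvPolynomial V k) w A = b at *
      generalize lowerSign (MvPolynomial V k) w (A.erase v) = p at *
      generalize lowerSign (MvPolynomial V k) v (insert w (A.erase v)) = q at *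
      linear_combination (X w * divX k v (c (insert w (A.erase v)))) *
        (p * b * h1 - a * p * h2 - q * b * h3)
    have h2 := lowerSign_mul_self (MvPolynomial V k) v (A.erase v)
    have hsum : ∑ w ∈ Aᶜ, (lowerSign (MvPolynomial V k) w A * X w) •
        (if v ∈ insert w A then lowerSign (MvPolynomial V k) v ((insert w A).erase v) *
          divX k v (c ((insert w A).erase v)) else 0) = c A := by
      simp only [Finset.mem_insert, hv, or_true, if_true]
      linear_combination hs + c A * h2 - lowerSign (MvPolynomial V k) v (A.erase v) * hD
    rw [hsum, sub_self]
  · rw [Finset.sum_eq_single v]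
    · have h1 := X_mul_divX_add_modMonomial v (c A)
      have h2 := lowerSign_mul_self (MvPolynomial V k) v A
      simp only [Finset.mem_insert_self, if_true, Finset.erase_insert hv, smul_eq_mul]
      linear_combination -h1 - (X v * divX k v (c A)) * h2
    · intro w hw hwv
      rw [if_neg (by simp [hv, hwv.symm]), smul_zero]
    · intro h
      simp [hv] at h

/-- The variables of `W` are eliminated one at a time; subtracting a boundary leaves a cycle, so the
step can be repeated. What survives involves `W` neither in its exterior nor in its polynomial
factor. -/
theorem exists_koszul_eliminate_finset (W : Finset V) (c : Finset V → MvPolynomial V k)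
    (hc : koszul (X : V → MvPolynomial V k) c = 0) : ∃ e : Finset V → MvPolynomial V k, ∀ A m,
      coeff m ((c - koszul (X : V → MvPolynomial V k) e) A) =
        if Disjoint A W ∧ Disjoint m.support W then coeff m (c A) else 0 := by
  induction W using Finset.induction_on with
  | empty => exact ⟨0, fun A m => by simp⟩
  | insert v W hv ih =>
    obtain ⟨e, he⟩ := ih
    obtain ⟨e', he'⟩ := exists_koszul_eliminate v (c - koszul (X : V → MvPolynomial V k) e) (by
      rw [map_sub, hc, koszul_koszul, sub_zero])
    refine ⟨e + e', fun A m => ?_⟩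
    rw [map_add, ← sub_sub, he' A]
    simp only [Finset.disjoint_insert_right]
    by_cases hA : v ∈ A
    · simp [hA]
    · simp only [hA, if_false, not_false_eq_true, true_and]
      by_cases hm : v ∈ m.support
      · rw [coeff_modMonomial_of_le, if_neg (by tauto)]
        simp at hm
        simp
        omega
      · rw [coeff_modMonomial_of_not_le, he]
        · simp [hm]
        · simp at hm
          simp
          omega

/-- The Koszul complex of the variables is a resolution of the residue field. -/
theorem koszul_X_exact (c : Finset V → MvPolynomial V k)
    (hc : koszul (X : V → MvPolynomial V k) c = 0)
    (h0 : coeff 0 (c ∅) = 0) :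
    ∃ e : Finset V → MvPolynomial V k, koszul (X : V → MvPolynomial V k) e = c := by
  -- With all variables eliminated only the constant term of `c ∅` could survive, and it is zero by
  -- `h0`.
  obtain ⟨e, he⟩ := exists_koszul_eliminate_finset Finset.univ c hc
  refine ⟨e, ?_⟩
  ext A m
  have h := he A m
  rw [Pi.sub_apply, coeff_sub] at h
  split_ifs at h with h1
  · simp only [← Finset.top_eq_univ, disjoint_top, Finset.bot_eq_empty,
      Finsupp.support_eq_empty] at h1
    rw [h1.1, h1.2, h0] at h
    rw [h1.1, h1.2, h0]
    linear_combination -h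
  · linear_combination -h

/-- The Koszul complex of the variables with coefficients in a free module is a resolution. -/
theorem koszul_X_exact_pi {p r : ℕ} (c : Finset V → Fin r → MvPolynomial V k)
    (hp : IsChainOfDegree p c) (hc : koszul (X : V → MvPolynomial V k) c = 0)
    (h0 : ∀ g, coeff 0 (c ∅ g) = 0) :
    ∃ e : Finset V → Fin r → MvPolynomial V k, IsChainOfDegree (p + 1) e ∧
      koszul (X : V → MvPolynomial V k) e = c := by
  have h (g : Fin r) : ∃ e : Finset V → MvPolynomial V k,
      koszul (X : V → MvPolynomial V k) e = fun A => c A g := by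
    refine koszul_X_exact _ ?_ (h0 g)
    have := koszul_comp (X : V → MvPolynomial V k) (LinearMap.proj (R := MvPolynomial V k)
      (φ := fun _ : Fin r => MvPolynomial V k) g) c
    simp only [LinearMap.proj_apply] at this
    rw [this, hc]
    rfl
  choose e he using h
  refine hp.exists_koszul_eq (X : V → MvPolynomial V k) (e := fun A g => e g A) ?_
  ext A g : 2
  rw [← congrFun (he g) A]
  simp [koszul_apply]

end KoszulPolynomial

/-! ### Koszul homology along a free resolution -/

section Syzygies

/-- Lifts are chosen coefficientwise, and replaced by `0` off degree `p` so that they again form a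
chain of degree `p`. -/
theorem IsChainOfDegree.exists_forall_of_forall {V M N : Type*} [AddCommGroup M] [AddCommGroup N]
    {p : ℕ} {c : Finset V → M} (hc : IsChainOfDegree p c) {P : Finset V → N → Prop} {φ : N → M}
    (hφ : φ 0 = 0) (h0 : ∀ A, P A 0) (h : ∀ A, ∃ n, P A n ∧ φ n = c A) :
    ∃ e : Finset V → N, IsChainOfDegree p e ∧ ∀ A, P A (e A) ∧ φ (e A) = c A := by
  choose e he using h
  refine ⟨fun A => if A.card = p then e A else 0, fun A hA => ?_, fun A => ?_⟩
  · by_contra h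
    exact hA (if_neg h)
  · dsimp only
    split_ifs with hA
    · exact he A
    · exact ⟨h0 A, by rw [hφ]; by_contra h; exact hA (hc A (Ne.symm h))⟩

theorem IsChainOfDegree.map {V M N : Type*} [AddCommGroup M] [AddCommGroup N]
    {p : ℕ} {c : Finset V → M} (hc : IsChainOfDegree p c) {φ : M → N} (hφ : φ 0 = 0) :
    IsChainOfDegree p fun A => φ (c A) :=
  fun A hA => hc A fun h => hA (by simp only [h, hφ])

theorem IsChainOfDegree.apply_empty {V M : Type*} [AddCommGroup M]
    {p : ℕ} {c : Finset V → M} (hc : IsChainOfDegree (p + 1) c) : c ∅ = 0 := by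
  by_contra h
  simpa using hc ∅ h

variable (k : Type*) [Field k] (V : Type*)

/-- The component of degree `d` of an element of the graded free module `⨁ g, S(-a g)`. -/
noncomputable def gradedFreeComponent {r : ℕ} (a : Fin r → ℕ) (d : ℕ) :
    (Fin r → MvPolynomial V k) →+ (Fin r → MvPolynomial V k) where
  toFun f g := if a g ≤ d then homogeneousComponent (d - a g) (f g) else 0
  map_zero' := by
    ext g : 1
    simp
  map_add' f f' := by
    ext g : 1
    by_cases h : a g ≤ d <;> simp [h]

variable {k V}

theorem gradedFreeComponent_apply {r : ℕ} (a : Fin r → ℕ) (d : ℕ) (f : Fin r → MvPolynomial V k)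
    (g : Fin r) : gradedFreeComponent k V a d f g =
      if a g ≤ d then homogeneousComponent (d - a g) (f g) else 0 := rfl

theorem gradedFreeComponent_mem {r : ℕ} (a : Fin r → ℕ) (d : ℕ) (f : Fin r → MvPolynomial V k) :
    gradedFreeComponent k V a d f ∈ gradedFreePart k V a d := by
  intro g
  rw [gradedFreeComponent_apply]
  split_ifs with h
  · exact Or.inl ⟨h, homogeneousComponent_isHomogeneous _ _⟩
  · exact Or.inr ⟨by omega, rfl⟩

theorem zero_mem_gradedFreePart {r : ℕ} (a : Fin r → ℕ) (d : ℕ) :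
    (0 : Fin r → MvPolynomial V k) ∈ gradedFreePart k V a d := by
  intro g
  rcases le_or_gt (a g) d with h | h
  · exact Or.inl ⟨h, isHomogeneous_zero _ _ _⟩
  · exact Or.inr ⟨h, rfl⟩

theorem gradedFreeComponent_of_mem {r : ℕ} {a : Fin r → ℕ} {d e : ℕ}
    {f : Fin r → MvPolynomial V k} (hf : f ∈ gradedFreePart k V a e) :
    gradedFreeComponent k V a d f = if d = e then f else 0 := by
  ext g : 1
  rw [gradedFreeComponent_apply]
  rcases hf g with ⟨h1, h2⟩ | ⟨h1, h2⟩
  · split_ifs with h3 h4 h4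
    · rw [h4, homogeneousComponent_of_mem h2, if_pos rfl]
    · rw [homogeneousComponent_of_mem h2, if_neg (by omega), Pi.zero_apply]
    · omega
    · rfl
  · rw [h2]
    split_ifs <;> simp [h2]

theorem exists_eq_sum_gradedFreeComponent {r : ℕ} (a : Fin r → ℕ)
    (f : Fin r → MvPolynomial V k) :
    ∃ D, f = ∑ d ∈ Finset.range D, gradedFreeComponent k V a d f := by
  -- The sum is a convenient bound exceeding every `a g + (f g).totalDegree`.
  refine ⟨∑ g, (a g + (f g).totalDegree + 1), ?_⟩
  ext g : 1
  rw [Finset.sum_apply]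
  simp only [gradedFreeComponent_apply]
  have hle : a g + (f g).totalDegree + 1 ≤ ∑ g, (a g + (f g).totalDegree + 1) :=
    Finset.single_le_sum (f := fun g => a g + (f g).totalDegree + 1) (fun _ _ => Nat.zero_le _)
      (Finset.mem_univ g)
  obtain ⟨D, hD⟩ := Nat.exists_eq_add_of_le hle
  rw [hD, show a g + (f g).totalDegree + 1 + D = a g + ((f g).totalDegree + 1 + D) by ring,
    Finset.sum_range_add, Finset.sum_eq_zero, zero_add, Finset.sum_range_add]
  · simp only [le_add_iff_nonneg_right, zero_le, if_true, Nat.add_sub_cancel_left]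
    rw [sum_homogeneousComponent, Finset.sum_eq_zero, add_zero]
    intro d _
    exact homogeneousComponent_eq_zero _ _ (by omega)
  · intro d hd
    rw [if_neg (by simpa using hd)]

/-- A graded homomorphism of graded free modules commutes with taking components. -/
theorem gradedFreeComponent_map {r s : ℕ} {a : Fin r → ℕ} {b : Fin s → ℕ}
    (φ : (Fin s → MvPolynomial V k) →ₗ[MvPolynomial V k] (Fin r → MvPolynomial V k))
    (hφ : ∀ e, ∀ f ∈ gradedFreePart k V b e, φ f ∈ gradedFreePart k V a e)
    (d : ℕ) (f : Fin s → MvPolynomial V k) :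
    gradedFreeComponent k V a d (φ f) = φ (gradedFreeComponent k V b d f) := by
  obtain ⟨D, hD⟩ := exists_eq_sum_gradedFreeComponent b f
  have h1 (e : ℕ) : gradedFreeComponent k V a d (φ (gradedFreeComponent k V b e f)) =
      φ (gradedFreeComponent k V b d (gradedFreeComponent k V b e f)) := by
    have h2 := gradedFreeComponent_mem b e f
    rw [gradedFreeComponent_of_mem (hφ _ _ h2), gradedFreeComponent_of_mem h2]
    split_ifs <;> simp
  rw [hD]
  simp only [map_sum, h1]

theorem mul_mem_gradedFreePart {r : ℕ} {a : Fin r → ℕ} {e d : ℕ} {p : MvPolynomial V k}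
    (hp : p.IsHomogeneous d) {f : Fin r → MvPolynomial V k} (hf : f ∈ gradedFreePart k V a e) :
    p • f ∈ gradedFreePart k V a (e + d) := by
  intro g
  rw [Pi.smul_apply, smul_eq_mul]
  rcases hf g with ⟨h1, h2⟩ | ⟨h1, h2⟩
  · refine Or.inl ⟨by omega, ?_⟩
    rw [show e + d - a g = d + (e - a g) by omega]
    exact hp.mul h2
  · rw [h2, mul_zero]
    exact zero_mem_gradedFreePart a (e + d) g

theorem add_mem_gradedFreePart {r : ℕ} {a : Fin r → ℕ} {e : ℕ} {f f' : Fin r → MvPolynomial V k}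
    (hf : f ∈ gradedFreePart k V a e) (hf' : f' ∈ gradedFreePart k V a e) :
    f + f' ∈ gradedFreePart k V a e := by
  intro g
  rw [Pi.add_apply]
  rcases hf g with ⟨h1, h2⟩ | ⟨h1, h2⟩ <;> rcases hf' g with ⟨h3, h4⟩ | ⟨h3, h4⟩
  · exact Or.inl ⟨h1, h2.add h4⟩
  · omega
  · omega
  · exact Or.inr ⟨h1, by rw [h2, h4, add_zero]⟩

theorem sum_mem_gradedFreePart {ι : Type*} {r : ℕ} {a : Fin r → ℕ} {e : ℕ} (s : Finset ι)
    {f : ι → Fin r → MvPolynomial V k} (hf : ∀ i ∈ s, f i ∈ gradedFreePart k V a e) :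
    ∑ i ∈ s, f i ∈ gradedFreePart k V a e :=
  Finset.sum_induction f (· ∈ gradedFreePart k V a e) (fun _ _ => add_mem_gradedFreePart)
    (zero_mem_gradedFreePart a e) hf

theorem IsChainOfDegree.eq_single_empty {V M : Type*} [DecidableEq V] [AddCommGroup M]
    {c : Finset V → M} (hc : IsChainOfDegree 0 c) : c = Pi.single ∅ (c ∅) := by
  ext A : 1
  by_cases h : A = ∅
  · rw [h, Pi.single_eq_same]
  · rw [Pi.single_eq_of_ne h]
    by_contra h'
    exact h (Finset.card_eq_zero.mp (hc A h'))

theorem isChainOfDegree_single_empty {V M : Type*} [DecidableEq V] [AddCommGroup M] (f : M) :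
    IsChainOfDegree 0 (Pi.single ∅ f : Finset V → M) := by
  intro A hA
  rw [Finset.card_eq_zero]
  by_contra h
  exact hA (Pi.single_eq_of_ne h _)

variable [LinearOrder V]

theorem isHomogeneous_lowerSign_mul_X (v : V) (A : Finset V) :
    (lowerSign (MvPolynomial V k) v A * X v).IsHomogeneous 1 := by
  unfold lowerSign
  rcases neg_one_pow_eq_or (MvPolynomial V k) (A.filter (· < v)).card with h | h <;> rw [h]
  · rw [one_mul]
    exact isHomogeneous_X k v
  · rw [neg_one_mul]
    exact (isHomogeneous_X k v).neg

variable [Fintype V]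

theorem koszul_mem_gradedFreePart {r : ℕ} {a : Fin r → ℕ} {e : ℕ}
    {c : Finset V → Fin r → MvPolynomial V k} (hc : ∀ A, c A ∈ gradedFreePart k V a e)
    (A : Finset V) : koszul (X : V → MvPolynomial V k) c A ∈ gradedFreePart k V a (e + 1) :=
  sum_mem_gradedFreePart _ fun v _ =>
    mul_mem_gradedFreePart (isHomogeneous_lowerSign_mul_X v A) (hc _)

theorem koszul_single_empty {R M : Type*} [CommRing R] [AddCommGroup M] [Module R M] (x : V → R)
    (f : M) : koszul x (Pi.single ∅ f) = 0 := by
  ext A : 1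
  rw [koszul_apply]
  exact Finset.sum_eq_zero fun v _ => by
    rw [Pi.single_eq_of_ne (Finset.insert_ne_empty v A), smul_zero]

/-- Elements of a free module without constant terms are Koszul boundaries. -/
theorem exists_koszul_eq_single_empty {r : ℕ} (f : Fin r → MvPolynomial V k)
    (hf : ∀ g, coeff 0 (f g) = 0) : ∃ e : Finset V → Fin r → MvPolynomial V k,
      IsChainOfDegree 1 e ∧ koszul (X : V → MvPolynomial V k) e = Pi.single ∅ f :=
  koszul_X_exact_pi (p := 0) _ (isChainOfDegree_single_empty f) (koszul_single_empty _ f)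
    (by simpa using hf)

theorem coeff_zero_koszul_X {r : ℕ} (c : Finset V → Fin r → MvPolynomial V k) (A : Finset V)
    (g : Fin r) : coeff 0 (koszul (X : V → MvPolynomial V k) c A g) = 0 := by
  rw [koszul_apply, Finset.sum_apply, coeff_sum]
  refine Finset.sum_eq_zero fun v _ => ?_
  rw [Pi.smul_apply, smul_eq_mul, mul_comm (lowerSign _ v A), mul_assoc]
  simp [coeff_X_mul']

variable {rank : ℕ → ℕ} {shift : ∀ i, Fin (rank i) → ℕ}
  (d : ∀ i, (Fin (rank (i + 1)) → MvPolynomial V k) →ₗ[MvPolynomial V k]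
    (Fin (rank i) → MvPolynomial V k))

/-- If the `(i + p)`-th module of a graded free resolution has no generator of degree `j`, then
the degree `j` part of the `p`-th Koszul homology of the `i`-th syzygy module is zero. -/
theorem koszulHomology_syzygy_eq_zero
    (hgr : ∀ i e, ∀ f ∈ gradedFreePart k V (shift (i + 1)) e,
      d i f ∈ gradedFreePart k V (shift i) e)
    (hex : ∀ i, Function.Exact (d (i + 1)) (d i)) {j : ℕ} (p : ℕ) :
    ∀ (i e : ℕ), (∀ g, shift (i + p) g ≠ j) → e + p = j →
    ∀ c : Finset V → Fin (rank i) → MvPolynomial V k, IsChainOfDegree p c →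
      (∀ A, c A ∈ gradedFreePart k V (shift i) e) →
      (∀ A, koszul (X : V → MvPolynomial V k) c A ∈ LinearMap.range (d i)) →
      ∃ b : Finset V → Fin (rank i) → MvPolynomial V k, IsChainOfDegree (p + 1) b ∧
        ∀ A, (c - koszul (X : V → MvPolynomial V k) b) A ∈ LinearMap.range (d i) := by
  induction p with
  | zero =>
    intro i e hi he c hc hcg _
    -- Here `e = j`. A nonzero constant term of `c ∅ g` would need a generator of degree `j`, so `c
    -- ∅` lies in `𝔪 F_i` and is a boundary.
    obtain ⟨b, hb1, hb⟩ := exists_koszul_eq_single_empty (V := V) (c ∅) (by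
      intro g
      rcases hcg ∅ g with ⟨h1, h2⟩ | ⟨h1, h2⟩
      · refine h2.coeff_eq_zero ?_
        have := hi g
        simp only [Nat.add_zero] at this
        simp
        omega
      · rw [h2, coeff_zero])
    refine ⟨b, hb1, fun A => ?_⟩
    rw [hb, ← hc.eq_single_empty, sub_self]
    exact zero_mem _
  | succ p ih =>
    intro i e hi he c hc hcg hcz
    -- Dimension shift: the boundary of `c` lifts through `d i` to a chain `c'`, which can be made
    -- homogeneous by taking components. The Koszul degree drops by one while the syzygy index and
    -- the internal degree rise by one, so `i + p` and `e + p` are preserved.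
    obtain ⟨c', hc', h'⟩ :=
      (isChainOfDegree_koszul (X : V → MvPolynomial V k) hc).exists_forall_of_forall
        (P := fun _ f => f ∈ gradedFreePart k V (shift (i + 1)) (e + 1)) (φ := d i) (map_zero _)
        (fun _ => zero_mem_gradedFreePart _ _) (fun A => by
          obtain ⟨f, hf⟩ := hcz A
          refine ⟨gradedFreeComponent k V (shift (i + 1)) (e + 1) f,
            gradedFreeComponent_mem _ _ _, ?_⟩
          rw [← gradedFreeComponent_map (d i) (hgr i), hf,
            gradedFreeComponent_of_mem (koszul_mem_gradedFreePart hcg A), if_pos rfl])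
    have hdc' : (fun A => d i (c' A)) = koszul (X : V → MvPolynomial V k) c :=
      funext fun A => (h' A).2
    obtain ⟨b, hb1, hb⟩ := ih (i + 1) (e + 1) (by
      intro g
      have := hi
      rw [show i + (p + 1) = i + 1 + p by omega] at this
      exact this g) (by omega) c' hc' (fun A => (h' A).1) (fun A => by
        rw [LinearMap.mem_range, ← Set.mem_range, ← hex i]
        have := congrFun (koszul_comp (X : V → MvPolynomial V k) (d i) c') A
        rw [← this, hdc', koszul_koszul, Pi.zero_apply])
    -- Correcting `c` by an element of the range of `d i` gives a true cycle in the free module,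
    -- where positive-degree Koszul homology vanishes.
    have hcyc : koszul (X : V → MvPolynomial V k) (c - fun A => d i (b A)) = 0 := by
      rw [map_sub, ← hdc', koszul_comp]
      ext A : 1
      rw [Pi.sub_apply, ← map_sub, Pi.zero_apply]
      exact (hex i _).mpr (hb A)
    have hchain : IsChainOfDegree (p + 1) (c - fun A => d i (b A)) := by
      intro A hA
      by_contra hp
      refine hA ?_
      have h1 : c A = 0 := by by_contra h; exact hp (hc A h)
      have h2 : b A = 0 := by by_contra h; exact hp (hb1 A h)
      rw [Pi.sub_apply, h1, h2, map_zero, sub_zero]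
    obtain ⟨e', he1, he2⟩ := koszul_X_exact_pi _ hchain hcyc (fun g => by
      rw [hchain.apply_empty, Pi.zero_apply, coeff_zero])
    refine ⟨e', he1, fun A => ?_⟩
    rw [he2, sub_sub_cancel]
    exact ⟨b A, rfl⟩

/-- In a minimal free resolution, if the `(p + i)`-th Koszul homology of the zeroth syzygy module
vanishes, then so does the `p`-th Koszul homology of the `i`-th syzygy module. -/
theorem koszulHomology_syzygy_succ (hex : ∀ i, Function.Exact (d (i + 1)) (d i))
    (hmin : ∀ i f g, coeff 0 (d i f g) = 0)
    (i : ℕ) : ∀ p, Fintype.card V < i + p →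
    ∀ c : Finset V → Fin (rank i) → MvPolynomial V k, IsChainOfDegree p c →
      (∀ A, koszul (X : V → MvPolynomial V k) c A ∈ LinearMap.range (d i)) →
      ∃ b : Finset V → Fin (rank i) → MvPolynomial V k, IsChainOfDegree (p + 1) b ∧
        ∀ A, (c - koszul (X : V → MvPolynomial V k) b) A ∈ LinearMap.range (d i) := by
  induction i with
  | zero =>
    intro p hp c hc _
    refine ⟨0, fun A hA => (hA rfl).elim, fun A => ?_⟩
    -- There are no subsets with `p > |V|` elements.
    have h0 : c A = 0 := by
      by_contra h
      have := hc A h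
      have := A.card_le_univ
      omega
    rw [map_zero, sub_zero, h0]
    exact zero_mem _
  | succ i ih =>
    intro p hp c hc hcz
    -- The shift in the other direction: `d i` applied to `c` is a cycle in the free module, hence
    -- the boundary of a chain `e` of degree `p + 1`, to which the induction hypothesis applies.
    -- Minimality supplies the vanishing constant term needed when `p = 0`.
    have hcyc : koszul (X : V → MvPolynomial V k) (fun A => d i (c A)) = 0 := by
      rw [koszul_comp]
      ext A : 1
      exact (hex i _).mpr (hcz A)
    obtain ⟨e, he1, he2⟩ := koszul_X_exact_pi _ (hc.map (map_zero (d i))) hcyc (hmin i _)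
    obtain ⟨b, hb1, hb⟩ := ih (p + 1) (by omega) e he1 (fun A => by
      rw [he2]
      exact ⟨_, rfl⟩)
    have hchain : IsChainOfDegree (p + 1) (e - koszul (X : V → MvPolynomial V k) b) := by
      intro A hA
      by_contra hp
      refine hA ?_
      have h1 : e A = 0 := by by_contra h; exact hp (he1 A h)
      have h2 : koszul (X : V → MvPolynomial V k) b A = 0 := by
        by_contra h
        exact hp (isChainOfDegree_koszul _ hb1 A h)
      rw [Pi.sub_apply, h1, h2, sub_zero]
    obtain ⟨e', he', h'⟩ := hchain.exists_forall_of_forall (P := fun _ _ => True) (φ := d i)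
      (map_zero _) (fun _ => trivial) (fun A => by
        obtain ⟨f, hf⟩ := hb A
        exact ⟨f, trivial, hf⟩)
    have hde : (fun A => d i (e' A)) = e - koszul (X : V → MvPolynomial V k) b :=
      funext fun A => (h' A).2
    refine ⟨e', he', fun A => ?_⟩
    rw [LinearMap.mem_range, ← Set.mem_range, ← hex i, Pi.sub_apply, map_sub]
    have := congrFun (koszul_comp (X : V → MvPolynomial V k) (d i) e') A
    rw [← this, hde, map_sub, koszul_koszul, sub_zero, he2, sub_self]

/-- A minimal free resolution over the polynomial ring has at most as many steps as there are
variables. -/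
theorem rank_eq_zero_of_minimal (hex : ∀ i, Function.Exact (d (i + 1)) (d i))
    (hmin : ∀ i f g, coeff 0 (d i f g) = 0) {i : ℕ} (hi : Fintype.card V < i) : rank i = 0 := by
  by_contra h
  let g : Fin (rank i) := ⟨0, Nat.pos_of_ne_zero h⟩
  -- A basis vector would be a sum of a Koszul boundary and an element of the range of `d i`;
  -- neither has constant terms, but the basis vector has one.
  obtain ⟨b, -, hb⟩ := koszulHomology_syzygy_succ d hex hmin i 0 hi
    (Pi.single ∅ (Pi.single g 1)) (isChainOfDegree_single_empty _) (fun A => by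
      rw [koszul_single_empty]
      exact zero_mem _)
  obtain ⟨f, hf⟩ := hb ∅
  have h1 := hmin i f g
  rw [hf, Pi.sub_apply, Pi.sub_apply, coeff_sub, coeff_zero_koszul_X] at h1
  simp at h1

end Syzygies

/-! ### Existence of minimal graded free resolutions -/

section Existence

variable {k : Type*} [Field k] {V : Type*}

theorem linearCombination_mem_gradedFreePart {r s : ℕ} {a : Fin r → ℕ} {b : Fin s → ℕ}
    {n : Fin s → Fin r → MvPolynomial V k} (hn : ∀ g, n g ∈ gradedFreePart k V a (b g)) (e : ℕ)
    (f : Fin s → MvPolynomial V k) (hf : f ∈ gradedFreePart k V b e) :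
    Fintype.linearCombination (MvPolynomial V k) n f ∈ gradedFreePart k V a e := by
  rw [Fintype.linearCombination_apply]
  refine sum_mem_gradedFreePart _ fun g _ => ?_
  rcases hf g with ⟨h1, h2⟩ | ⟨h1, h2⟩
  · have := mul_mem_gradedFreePart h2 (hn g)
    rwa [Nat.add_sub_cancel' h1] at this
  · rw [h2, zero_smul]
    exact zero_mem_gradedFreePart a e

/-- A homogeneous submodule of a graded free module of finite rank is generated by finitely many
homogeneous elements. -/
theorem exists_homogeneous_generators [Finite V] {r : ℕ} (a : Fin r → ℕ)
    (N : Submodule (MvPolynomial V k) (Fin r → MvPolynomial V k))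
    (hN : ∀ f ∈ N, ∀ d, gradedFreeComponent k V a d f ∈ N) :
    ∃ (s : ℕ) (b : Fin s → ℕ) (n : Fin s → Fin r → MvPolynomial V k),
      (∀ g, n g ∈ gradedFreePart k V a (b g)) ∧
        Submodule.span (MvPolynomial V k) (Set.range n) = N := by
  obtain ⟨G, hG⟩ := IsNoetherian.noetherian N
  choose D hD using fun f : Fin r → MvPolynomial V k => exists_eq_sum_gradedFreeComponent a f
  let ι := Σ f : G, Fin (D f)
  let E := (Fintype.equivFin ι).symm
  refine ⟨Fintype.card ι, fun i => (E i).2, fun i => gradedFreeComponent k V a (E i).2 (E i).1,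
    fun i => gradedFreeComponent_mem _ _ _, le_antisymm ?_ ?_⟩
  · rw [Submodule.span_le]
    rintro _ ⟨i, rfl⟩
    refine hN _ ?_ _
    rw [← hG]
    exact Submodule.subset_span (E i).1.2
  · conv_lhs => rw [← hG]
    rw [Submodule.span_le]
    intro f hf
    rw [SetLike.mem_coe, hD f]
    refine Submodule.sum_mem _ fun d hd => Submodule.subset_span ?_
    exact ⟨E.symm ⟨⟨f, hf⟩, ⟨d, Finset.mem_range.mp hd⟩⟩,
      congrArg (fun i : ι => gradedFreeComponent k V a i.2 i.1) (E.apply_symm_apply _)⟩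

/-- A homogeneous submodule of a graded free module of finite rank has a minimal system of
homogeneous generators. -/
theorem exists_minimal_homogeneous_generators [Finite V] {r : ℕ} (a : Fin r → ℕ)
    (N : Submodule (MvPolynomial V k) (Fin r → MvPolynomial V k))
    (hN : ∀ f ∈ N, ∀ d, gradedFreeComponent k V a d f ∈ N) :
    ∃ (s : ℕ) (b : Fin s → ℕ) (n : Fin s → Fin r → MvPolynomial V k),
      (∀ g, n g ∈ gradedFreePart k V a (b g)) ∧
        Submodule.span (MvPolynomial V k) (Set.range n) = N ∧
        ∀ f, Fintype.linearCombination (MvPolynomial V k) n f = 0 → ∀ g, coeff 0 (f g) = 0 := by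
  classical
  have hex := exists_homogeneous_generators a N hN
  obtain ⟨b, n, hb, hn⟩ := Nat.find_spec hex
  refine ⟨Nat.find hex, b, n, hb, hn, fun f hf g => ?_⟩
  have hmin := fun m => Nat.find_min (m := m) hex
  generalize Nat.find hex = s at *
  by_contra hg
  obtain _ | s := s
  · exact g.elim0
  · refine hmin s (Nat.lt_succ_self s) ⟨b ∘ g.succAbove, n ∘ g.succAbove, fun i => hb _, ?_⟩
    -- In its component of degree `b g`, the relation has at `g` exactly the constant `coeff 0 (f
    -- g)`, a unit. So `n g` is redundant, against the choice of the least number of generators.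
    set f' := gradedFreeComponent k V b (b g) f with hf'
    have h1 : Fintype.linearCombination (MvPolynomial V k) n f' = 0 := by
      rw [hf', ← gradedFreeComponent_map (a := a) _ (linearCombination_mem_gradedFreePart hb), hf,
        map_zero]
    have h2 : f' g = C (coeff 0 (f g)) := by
      rw [hf', gradedFreeComponent_apply, if_pos le_rfl, Nat.sub_self, homogeneousComponent_zero]
    rw [Fintype.linearCombination_apply, Fin.sum_univ_succAbove _ g, h2] at h1
    rw [← hn]
    refine le_antisymm (Submodule.span_mono (Set.range_comp_subset_range _ _)) ?_
    rw [Submodule.span_le]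
    rintro _ ⟨i, rfl⟩
    by_cases hi : i = g
    · subst hi
      have h3 : n i = (-C (coeff 0 (f i))⁻¹ : MvPolynomial V k) •
          ∑ j, f' (i.succAbove j) • n (i.succAbove j) := by
        have h4 : (C (coeff 0 (f i))⁻¹ : MvPolynomial V k) * C (coeff 0 (f i)) = 1 := by
          rw [← C_mul, inv_mul_cancel₀ hg, C_1]
        rw [← eq_neg_iff_add_eq_zero] at h1
        rw [neg_smul, ← smul_neg, ← h1, smul_smul, h4, one_smul]
      rw [h3]
      exact Submodule.smul_mem _ _ (Submodule.sum_mem _ fun j _ =>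
        Submodule.smul_mem _ _ (Submodule.subset_span ⟨j, rfl⟩))
    · obtain ⟨j, rfl⟩ := Fin.exists_succAbove_eq hi
      exact Submodule.subset_span ⟨j, rfl⟩

variable (k V) in
/-- A homogeneous submodule of a graded free module, consisting of elements without constant
terms. -/
structure HomogeneousSyzygyModule where
  rank : ℕ
  shift : Fin rank → ℕ
  carrier : Submodule (MvPolynomial V k) (Fin rank → MvPolynomial V k)
  component_mem : ∀ f ∈ carrier, ∀ d, gradedFreeComponent k V shift d f ∈ carrier
  coeff_zero : ∀ f ∈ carrier, ∀ g, coeff 0 (f g) = 0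

/-- One step of the resolution. Relations among a minimal system of generators have no constant
terms, so the kernel is again of the same kind and the step can be iterated. -/
theorem HomogeneousSyzygyModule.exists_cover [Finite V] (N : HomogeneousSyzygyModule k V) :
    ∃ (N' : HomogeneousSyzygyModule k V) (φ : (Fin N'.rank → MvPolynomial V k)
      →ₗ[MvPolynomial V k] (Fin N.rank → MvPolynomial V k)),
      (∀ e, ∀ f ∈ gradedFreePart k V N'.shift e, φ f ∈ gradedFreePart k V N.shift e) ∧
      LinearMap.range φ = N.carrier ∧ LinearMap.ker φ = N'.carrier := by
  obtain ⟨s, b, n, hb, hn, hmin⟩ :=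
    exists_minimal_homogeneous_generators N.shift N.carrier N.component_mem
  have hgr := linearCombination_mem_gradedFreePart hb
  refine ⟨⟨s, b, LinearMap.ker (Fintype.linearCombination (MvPolynomial V k) n), ?_, hmin⟩,
    Fintype.linearCombination (MvPolynomial V k) n, hgr, ?_, rfl⟩
  · intro f hf d
    rw [LinearMap.mem_ker] at hf ⊢
    rw [← gradedFreeComponent_map _ hgr, hf, map_zero]
  · rw [← hn, Fintype.range_linearCombination]

/-- A quotient of the polynomial ring by a proper homogeneous ideal has a minimal graded free
resolution of finite length. -/
theorem nonempty_minimalGradedFreeResolution [LinearOrder V] [Fintype V]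
    (I : Ideal (MvPolynomial V k)) (hI : ∀ p ∈ I, ∀ d, homogeneousComponent d p ∈ I)
    (hI0 : ∀ p ∈ I, coeff 0 p = 0) :
    Nonempty (MinimalGradedFreeResolution k V (MvPolynomial V k ⧸ I) fun d =>
      (homogeneousSubmodule V k d).map (Ideal.Quotient.mkₐ k I).toLinearMap) := by
  let aug : (Fin 1 → MvPolynomial V k) →ₗ[MvPolynomial V k] (MvPolynomial V k ⧸ I) :=
    (Submodule.mkQ I).comp (LinearMap.proj 0)
  have haug (f : Fin 1 → MvPolynomial V k) : aug f = Ideal.Quotient.mk I (f 0) := rfl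
  let N₀ : HomogeneousSyzygyModule k V :=
    { rank := 1
      shift := fun _ => 0
      carrier := LinearMap.ker aug
      component_mem := by
        intro f hf d
        rw [LinearMap.mem_ker, haug, Ideal.Quotient.eq_zero_iff_mem] at hf ⊢
        exact hI _ hf _
      coeff_zero := by
        intro f hf g
        rw [LinearMap.mem_ker, haug, Ideal.Quotient.eq_zero_iff_mem] at hf
        rw [Subsingleton.elim g 0]
        exact hI0 _ hf }
  choose next φ hgr hrange hker using fun N : HomogeneousSyzygyModule k V => N.exists_cover
  let N : ℕ → HomogeneousSyzygyModule k V := fun i => Nat.rec N₀ (fun _ => next) i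
  have hex (i : ℕ) : Function.Exact (φ (N (i + 1))) (φ (N i)) := by
    rw [LinearMap.exact_iff, hker, hrange]
  have hmin (i : ℕ) (f) (g) : coeff 0 (φ (N i) f g) = 0 :=
    (N i).coeff_zero _ (by rw [← hrange]; exact ⟨f, rfl⟩) g
  exact ⟨{
    rank := fun i => (N i).rank
    shift := fun i => (N i).shift
    d := fun i => φ (N i)
    aug := aug
    d_graded := fun i => hgr (N i)
    aug_graded := by
      intro e f hf
      refine ⟨f 0, ?_, rfl⟩
      rcases hf 0 with ⟨_, h⟩ | ⟨h, _⟩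
      · exact h
      · exact (Nat.not_lt_zero _ h).elim
    aug_surjective := by
      intro m
      obtain ⟨p, rfl⟩ := Ideal.Quotient.mk_surjective m
      exact ⟨fun _ => p, rfl⟩
    exact_zero := by
      rw [LinearMap.exact_iff]
      exact (hrange N₀).symm
    exact_succ := hex
    finite_length := ⟨Fintype.card V, fun i hi =>
      rank_eq_zero_of_minimal (rank := fun i => (N i).rank) (fun i => φ (N i)) hex hmin hi⟩
    minimal := fun i f g => (mem_span_range_X_iff _).mpr (hmin i f g) }⟩

end Existence

/-! ### The Stanley-Reisner ideal -/

section StanleyReisnerKoszul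

/-- The exponent of the squarefree monomial with support `σ`. -/
noncomputable def squarefreeExponent {V : Type*} (σ : Finset V) : V →₀ ℕ :=
  ∑ v ∈ σ, Finsupp.single v 1

theorem squarefreeExponent_apply {V : Type*} [DecidableEq V] (σ : Finset V) (v : V) :
    squarefreeExponent σ v = if v ∈ σ then 1 else 0 := by
  simp [squarefreeExponent, Finsupp.finsetSum_apply, Finsupp.single_apply]

theorem support_squarefreeExponent {V : Type*} (σ : Finset V) :
    (squarefreeExponent σ).support = σ := by
  classical
  ext v
  simp [squarefreeExponent_apply]

theorem degree_squarefreeExponent {V : Type*} (σ : Finset V) :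
    (squarefreeExponent σ).degree = σ.card := by
  simp [squarefreeExponent, map_sum]

theorem single_add_squarefreeExponent_erase {V : Type*} [DecidableEq V] {σ : Finset V} {v : V}
    (hv : v ∈ σ) : Finsupp.single v 1 + squarefreeExponent (σ.erase v) = squarefreeExponent σ :=
  Finset.add_sum_erase σ (fun v => Finsupp.single v 1) hv

namespace AbstractSimplicialComplex

variable {k : Type*} [Field k] {V : Type*} (Δ : AbstractSimplicialComplex V)

theorem IsFace.mono {Δ : AbstractSimplicialComplex V} {σ τ : Finset V} (hσ : Δ.IsFace σ)
    (h : τ ⊆ σ) : Δ.IsFace τ := by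
  rcases τ.eq_empty_or_nonempty with rfl | hτ
  · exact Or.inl rfl
  · rcases hσ with rfl | hσ
    · exact (hτ.ne_empty (Finset.subset_empty.mp h)).elim
    · exact Or.inr ((Δ.isRelLowerSet_faces hσ).2 h hτ)

/-- The ideal is monomial, and since faces are closed under subsets, a monomial is divisible by the
squarefree monomial of some nonface iff its own support is a nonface. -/
theorem mem_stanleyReisnerIdeal_iff (p : MvPolynomial V k) :
    p ∈ Δ.stanleyReisnerIdeal k ↔ ∀ m ∈ p.support, ¬ Δ.IsFace m.support := by
  have h1 : {p : MvPolynomial V k | ∃ σ : Finset V, ¬ Δ.IsFace σ ∧ p = ∏ v ∈ σ, X v} =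
      (fun s => monomial s (1 : k)) '' {s | ∃ σ, ¬ Δ.IsFace σ ∧ s = squarefreeExponent σ} := by
    ext p
    constructor
    · rintro ⟨σ, hσ, rfl⟩
      exact ⟨_, ⟨σ, hσ, rfl⟩, monomial_sum_one σ _⟩
    · rintro ⟨_, ⟨σ, hσ, rfl⟩, rfl⟩
      exact ⟨σ, hσ, monomial_sum_one σ _⟩
  rw [stanleyReisnerIdeal, h1, mem_ideal_span_monomial_image]
  refine forall₂_congr fun m _ => ⟨?_, fun h => ?_⟩
  · rintro ⟨_, ⟨σ, hσ, rfl⟩, hle⟩ hm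
    refine hσ (hm.mono ?_)
    rw [← support_squarefreeExponent σ]
    exact Finsupp.support_mono hle
  · refine ⟨_, ⟨m.support, h, rfl⟩, fun v => ?_⟩
    classical
    rw [squarefreeExponent_apply]
    split_ifs with hv
    · exact Nat.one_le_iff_ne_zero.mpr (Finsupp.mem_support_iff.mp hv)
    · exact Nat.zero_le _

theorem homogeneousComponent_mem_stanleyReisnerIdeal (p : MvPolynomial V k)
    (hp : p ∈ Δ.stanleyReisnerIdeal k) (d : ℕ) :
    homogeneousComponent d p ∈ Δ.stanleyReisnerIdeal k := by
  rw [mem_stanleyReisnerIdeal_iff] at hp ⊢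
  intro m hm
  refine hp m ?_
  rw [mem_support_iff, coeff_homogeneousComponent] at hm
  rw [mem_support_iff]
  intro h
  simp [h] at hm

theorem coeff_eq_zero_of_mem_stanleyReisnerIdeal {p : MvPolynomial V k}
    (hp : p ∈ Δ.stanleyReisnerIdeal k) {σ : Finset V} (hσ : Δ.IsFace σ) :
    coeff (squarefreeExponent σ) p = 0 := by
  by_contra h
  refine (Δ.mem_stanleyReisnerIdeal_iff p).mp hp _ (mem_support_iff.mpr h) ?_
  rwa [support_squarefreeExponent]

theorem coeff_zero_of_mem_stanleyReisnerIdeal (p : MvPolynomial V k)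
    (hp : p ∈ Δ.stanleyReisnerIdeal k) : coeff 0 p = 0 :=
  Δ.coeff_eq_zero_of_mem_stanleyReisnerIdeal hp (Or.inl rfl : Δ.IsFace ∅)

theorem monomial_mem_stanleyReisnerIdeal {σ : Finset V} (hσ : ¬ Δ.IsFace σ) (t : k) :
    monomial (squarefreeExponent σ) t ∈ Δ.stanleyReisnerIdeal k := by
  classical
  rw [mem_stanleyReisnerIdeal_iff]
  intro m hm
  rw [mem_support_iff, coeff_monomial] at hm
  have : squarefreeExponent σ = m := by
    by_contra h
    exact hm (if_neg h)
  rwa [← this, support_squarefreeExponent]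

/-- The unit of a Stanley-Reisner ring lifts to an element of degree zero of every graded free
module covering it. -/
theorem exists_lift_one (F : MinimalGradedFreeResolution k V (Δ.StanleyReisnerRing k)
    (Δ.stanleyReisnerGrading k)) : ∃ u ∈ gradedFreePart k V (F.shift 0) 0, F.aug u = 1 := by
  obtain ⟨u, hu⟩ := F.aug_surjective 1
  obtain ⟨D, hD⟩ := exists_eq_sum_gradedFreeComponent (F.shift 0) u
  have h1 (d : ℕ) := F.aug_graded d _ (gradedFreeComponent_mem (F.shift 0) d u)
  choose q hq hq' using h1
  refine ⟨_, gradedFreeComponent_mem (F.shift 0) 0 u, ?_⟩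
  have h2 : (1 : MvPolynomial V k) - ∑ d ∈ Finset.range D, q d ∈ Δ.stanleyReisnerIdeal k := by
    rw [← Ideal.Quotient.eq_zero_iff_mem, map_sub, map_one, map_sum, sub_eq_zero, ← hu]
    conv_lhs => rw [hD, map_sum]
    exact Finset.sum_congr rfl fun d _ => (hq' d).symm
  -- The degree zero part of this congruence says that `1` and `q 0` agree modulo the ideal.
  have h3 := Δ.homogeneousComponent_mem_stanleyReisnerIdeal _ h2 0
  rw [map_sub, map_sum, homogeneousComponent_of_mem (isHomogeneous_one V k), if_pos rfl] at h3
  have h4 : ∑ d ∈ Finset.range D, homogeneousComponent 0 (q d) = if 0 < D then q 0 else 0 := by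
    simp_rw [fun d => homogeneousComponent_of_mem (m := 0) (hq d)]
    simp
  rw [h4] at h3
  split_ifs at h3
  · rw [← Ideal.Quotient.eq_zero_iff_mem, map_sub, map_one, sub_eq_zero] at h3
    rw [h3]
    exact (hq' 0).symm
  · have := Δ.coeff_zero_of_mem_stanleyReisnerIdeal _ h3
    simp at this

/-! ### Squarefree Koszul chains and simplicial cochains -/

variable [LinearOrder V] [Fintype V]

theorem boundary_single (σ : Finset V) : boundary k V (Pi.single σ 1) =
    ∑ v ∈ σ, Pi.single (σ.erase v) (lowerSign k v σ) := by
  simp [boundary, lowerSign, Fintype.linearCombination_apply_single]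

/-- The simplicial boundary is the Koszul differential of a constant family. -/
theorem boundary_eq_koszul : boundary k V = koszul fun _ : V => (1 : k) := by
  refine LinearMap.pi_ext' fun σ => LinearMap.ext_ring ?_
  simp only [LinearMap.comp_apply, LinearMap.single_apply]
  rw [boundary_single]
  ext τ
  rw [Finset.sum_apply, koszul_apply]
  simp only [Pi.single_apply, mul_one, smul_eq_mul, mul_ite, mul_zero]
  rw [← Finset.sum_filter, ← Finset.sum_filter]
  have h1 : σ.filter (fun v => τ = σ.erase v) = τᶜ.filter (fun v => insert v τ = σ) := by
    ext v
    simp only [Finset.mem_filter, Finset.mem_compl]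
    constructor
    · rintro ⟨hv, rfl⟩
      exact ⟨by simp, Finset.insert_erase hv⟩
    · rintro ⟨hv, rfl⟩
      exact ⟨by simp, (Finset.erase_insert hv).symm⟩
  rw [h1]
  refine Finset.sum_congr rfl fun v hv => ?_
  rw [Finset.mem_filter, Finset.mem_compl] at hv
  rw [← hv.2, lowerSign_insert k hv.1]
  simp

theorem lowerSign_univ (v : V) (A : Finset V) :
    lowerSign k v Finset.univ = lowerSign k v A * lowerSign k v Aᶜ := by
  unfold lowerSign
  rw [← pow_add, ← Finset.card_union_of_disjoint, ← Finset.filter_union, Finset.union_compl]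
  exact Finset.disjoint_filter_filter disjoint_compl_right

variable (k) in
/-- The sign comparing the Koszul complex with the simplicial cochain complex. -/
def complementSign (A : Finset V) : k := ∏ a ∈ A, lowerSign k a Finset.univ

theorem complementSign_mul_self (A : Finset V) :
    complementSign k A * complementSign k A = 1 := by
  rw [complementSign, ← Finset.prod_mul_distrib]
  exact Finset.prod_eq_one fun a _ => lowerSign_mul_self k a _

/-- Adding `v` to `A` removes it from `Aᶜ`. After twisting by `complementSign`, the Koszul sign at
`A` becomes the simplicial sign at `Aᶜ`. -/
theorem lowerSign_mul_complementSign_insert {v : V} {A : Finset V} (hv : v ∉ A) :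
    lowerSign k v A * complementSign k (insert v A) =
      complementSign k A * lowerSign k v Aᶜ := by
  rw [complementSign, Finset.prod_insert hv, lowerSign_univ v A]
  have := lowerSign_mul_self k v A
  rw [complementSign]
  linear_combination (lowerSign k v Aᶜ * ∏ a ∈ A, lowerSign k a Finset.univ) * this

theorem C_lowerSign {V : Type*} [LinearOrder V] (v : V) (A : Finset V) :
    (C (lowerSign k v A) : MvPolynomial V k) = lowerSign (MvPolynomial V k) v A := by
  simp [lowerSign]

/-- The Koszul chain of multidegree `(1, …, 1)` attached to a simplicial cochain. -/
noncomputable def koszulCochain (p : ℕ) (φ : (Finset V → k) →ₗ[k] k) (A : Finset V) :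
    MvPolynomial V k :=
  if A.card = p then
    monomial (squarefreeExponent Aᶜ) (complementSign k A * φ (Pi.single Aᶜ 1)) else 0

theorem isChainOfDegree_koszulCochain (p : ℕ) (φ : (Finset V → k) →ₗ[k] k) :
    IsChainOfDegree p (koszulCochain p φ) := by
  intro A hA
  by_contra h
  exact hA (if_neg h)

theorem isHomogeneous_koszulCochain {p q : ℕ} (hpq : p + q = Fintype.card V)
    (φ : (Finset V → k) →ₗ[k] k) (A : Finset V) : (koszulCochain p φ A).IsHomogeneous q := by
  unfold koszulCochain
  split_ifs with h
  · refine isHomogeneous_monomial _ ?_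
    rw [degree_squarefreeExponent, Finset.card_compl]
    omega
  · exact isHomogeneous_zero _ _ _

/-- A cocycle gives a Koszul cycle over the Stanley-Reisner ring. -/
theorem koszul_koszulCochain_mem {p q : ℕ} (hpq : p + q = Fintype.card V)
    (φ : (Finset V → k) →ₗ[k] k) (hφ : ∀ c ∈ Δ.boundaries k (q - 1), φ c = 0) (A : Finset V) :
    koszul (X : V → MvPolynomial V k) (koszulCochain p φ) A ∈ Δ.stanleyReisnerIdeal k := by
  by_cases hA : A.card + 1 = p
  -- The coefficient is, up to sign, the coboundary of `φ` on `Aᶜ`: it vanishes if `Aᶜ` is a face,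
  -- and otherwise the monomial lies in the ideal.
  · have h1 : koszul (X : V → MvPolynomial V k) (koszulCochain p φ) A =
        monomial (squarefreeExponent Aᶜ)
          (complementSign k A * φ (boundary k V (Pi.single Aᶜ 1))) := by
      rw [koszul_apply, boundary_single, map_sum, Finset.mul_sum, map_sum]
      refine Finset.sum_congr rfl fun v hv => ?_
      have hvA : v ∉ A := by simpa using hv
      rw [koszulCochain, if_pos (by rw [Finset.card_insert_of_notMem hvA, hA]),
        Finset.compl_insert, ← C_lowerSign, smul_eq_mul, mul_assoc, X, monomial_mul, C_mul_monomial,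
        single_add_squarefreeExponent_erase hv, one_mul, ← mul_assoc,
        lowerSign_mul_complementSign_insert hvA, mul_assoc]
      congr 2
      rw [← smul_eq_mul, ← map_smul, ← Pi.single_smul', smul_eq_mul, mul_one]
    rw [h1]
    by_cases hF : Δ.IsFace Aᶜ
    · rw [hφ, mul_zero, monomial_zero]
      · exact zero_mem _
      · refine ⟨Pi.single Aᶜ 1, fun σ hσ => ?_, rfl⟩
        have : σ = Aᶜ := by
          by_contra h
          exact hσ (Pi.single_eq_of_ne h _)
        subst this
        refine ⟨hF, ?_⟩
        rw [Finset.card_compl]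
        omega
    · exact Δ.monomial_mem_stanleyReisnerIdeal hF _
  · rw [koszul_apply, Finset.sum_eq_zero]
    · exact zero_mem _
    · intro v hv
      rw [koszulCochain, Finset.card_insert_of_notMem (by simpa using hv), if_neg hA, smul_zero]

/-- If the Koszul cycle of a cochain `φ` is a boundary over the Stanley-Reisner ring, then `φ`
vanishes on simplicial cycles. -/
theorem apply_eq_zero_of_koszulCochain {p q : ℕ} (hpq : p + q = Fintype.card V)
    (φ : (Finset V → k) →ₗ[k] k) (b : Finset V → MvPolynomial V k)
    (hb : ∀ A, koszulCochain p φ A - koszul (X : V → MvPolynomial V k) b A ∈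
      Δ.stanleyReisnerIdeal k) (z : Finset V → k) (hz : z ∈ Δ.cycles k (q - 1)) : φ z = 0 := by
  -- Only the squarefree part of `b` matters: the coefficients of the monomials of `τ` in `b τᶜ`
  -- form a cochain `ψ` whose coboundary agrees with `φ` on faces with `q` elements.
  let ψ : (Finset V → k) →ₗ[k] k := Fintype.linearCombination k fun τ : Finset V =>
    complementSign k τᶜ * coeff (squarefreeExponent τ) (b τᶜ)
  have key (σ : Finset V) (hσ : Δ.IsFace σ) (hq : σ.card = q) :
      φ (Pi.single σ 1) = ψ (boundary k V (Pi.single σ 1)) := by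
    have h1 := Δ.coeff_eq_zero_of_mem_stanleyReisnerIdeal (hb σᶜ) hσ
    rw [coeff_sub, koszulCochain, if_pos (by rw [Finset.card_compl]; omega), compl_compl,
      coeff_monomial, if_pos rfl, koszul_apply, coeff_sum, compl_compl, sub_eq_zero] at h1
    rw [boundary_single, map_sum]
    have h2 := complementSign_mul_self (k := k) σᶜ
    have h3 : ∑ v ∈ σ, coeff (squarefreeExponent σ)
        ((lowerSign (MvPolynomial V k) v σᶜ * X v) • b (insert v σᶜ)) =
        complementSign k σᶜ * ∑ v ∈ σ, ψ (Pi.single (σ.erase v) (lowerSign k v σ)) := by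
      rw [Finset.mul_sum]
      refine Finset.sum_congr rfl fun v hv => ?_
      have h4 := lowerSign_mul_complementSign_insert (k := k) (v := v) (A := σᶜ) (by simpa using hv)
      have h5 := complementSign_mul_self (k := k) (insert v σᶜ)
      rw [smul_eq_mul, mul_assoc, ← C_lowerSign, coeff_C_mul,
        ← single_add_squarefreeExponent_erase hv, coeff_X_mul,
        Fintype.linearCombination_apply_single, Finset.compl_erase, smul_eq_mul]
      rw [compl_compl] at h4
      linear_combination (complementSign k (insert v σᶜ) *
        coeff (squarefreeExponent (σ.erase v)) (b (insert v σᶜ))) * h4 - (lowerSign k v σᶜ *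
        coeff (squarefreeExponent (σ.erase v)) (b (insert v σᶜ))) * h5
    rw [h3] at h1
    linear_combination (complementSign k σᶜ) * h1 - (φ (Pi.single σ 1) -
      ∑ v ∈ σ, ψ (Pi.single (σ.erase v) (lowerSign k v σ))) * h2
  have hsum : z = ∑ σ, z σ • (Pi.single σ 1 : Finset V → k) := by
    ext τ
    simp [Finset.sum_apply, Pi.single_apply]
  have hφ : φ z = ψ (boundary k V z) := by
    rw [hsum]
    simp only [map_sum, map_smul]
    refine Finset.sum_congr rfl fun σ _ => ?_
    by_cases h : z σ = 0
    · rw [h, zero_smul, zero_smul]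
    · obtain ⟨h1, h2⟩ := hz.1 σ h
      rw [key σ h1 (by omega)]
  rw [hφ, LinearMap.mem_ker.mp hz.2, map_zero]

/-- The reduced homology of `Δ` in degree `q - 1` contributes to the Betti number of the
Stanley-Reisner ring in homological degree `|V| - q` and internal degree `|V|`. -/
theorem exists_shift_eq_card {p q : ℕ} (hpq : p + q = Fintype.card V)
    (F : MinimalGradedFreeResolution k V (Δ.StanleyReisnerRing k) (Δ.stanleyReisnerGrading k))
    (z : Finset V → k) (hz : z ∈ Δ.cycles k (q - 1)) (hz' : z ∉ Δ.boundaries k (q - 1)) :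
    ∃ g, F.shift p g = p + q := by
  by_contra! hF
  -- Working with a separating functional avoids comparing homology with cohomology.
  obtain ⟨φ, hφz, hφ⟩ := Submodule.exists_le_ker_of_notMem hz'
  obtain ⟨u, hu, hu1⟩ := Δ.exists_lift_one F
  set c := koszulCochain p φ with hc
  have haug (r : MvPolynomial V k) : F.aug (r • u) = Ideal.Quotient.mk _ r := by
    have h := map_smul (Submodule.mkQ (Δ.stanleyReisnerIdeal k)) r 1
    rw [smul_eq_mul, mul_one] at h
    rw [map_smul, hu1]
    exact h.symm
  have hcu : koszul (X : V → MvPolynomial V k) (fun A => c A • u) =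
      fun A => koszul (X : V → MvPolynomial V k) c A • u :=
    koszul_comp _ (LinearMap.toSpanSingleton (MvPolynomial V k) _ u) c
  have hker (f) : F.aug f = 0 ↔ f ∈ LinearMap.range (F.d 0) := F.exact_zero f
  obtain ⟨b, -, hb⟩ := koszulHomology_syzygy_eq_zero F.d F.d_graded F.exact_succ p 0 q
    (by rw [Nat.zero_add]; exact hF) (add_comm q p) (fun A => c A • u)
    ((isChainOfDegree_koszulCochain p φ).map (φ := fun r => r • u) (zero_smul _ u))
    (fun A => by
      have := mul_mem_gradedFreePart (isHomogeneous_koszulCochain hpq φ A) hu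
      rwa [zero_add] at this)
    (fun A => by
      rw [hcu, ← hker, haug, Ideal.Quotient.eq_zero_iff_mem]
      exact Δ.koszul_koszulCochain_mem hpq φ (fun c hc => hφ hc) A)
  -- The bounding chain is pushed to the Stanley–Reisner ring and then lifted coefficientwise to
  -- polynomials.
  choose b' hb' using fun A => Ideal.Quotient.mk_surjective (F.aug (b A))
  refine hφz (Δ.apply_eq_zero_of_koszulCochain hpq φ b' (fun A => ?_) z hz)
  rw [← Ideal.Quotient.eq_zero_iff_mem, map_sub, sub_eq_zero, ← haug]
  have h1 := (hker _).mpr (hb A)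
  rw [Pi.sub_apply, map_sub, sub_eq_zero] at h1
  rw [h1]
  have h2 := congrFun (koszul_comp (X : V → MvPolynomial V k) F.aug b) A
  rw [← h2]
  have h3 := congrFun (koszul_comp (X : V → MvPolynomial V k)
    (Submodule.mkQ (Δ.stanleyReisnerIdeal k)) b') A
  have h4 : (fun A => F.aug (b A)) = fun A => Submodule.mkQ (Δ.stanleyReisnerIdeal k) (b' A) :=
    funext fun A => (hb' A).symm
  rw [h4]
  exact h3

/-- Nonvanishing reduced homology in degree `q - 1` bounds the regularity of the Stanley-Reisner
ring from below. -/
theorem le_stanleyReisnerRegularity {q : ℕ} (z : Finset V → k) (hz : z ∈ Δ.cycles k (q - 1))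
    (hz' : z ∉ Δ.boundaries k (q - 1)) :
    ((q : ℝ) : EReal) ≤ Δ.stanleyReisnerRegularity k := by
  -- A chain of dimension `q - 1` that is not zero contains a face with `q` elements.
  have hq : q ≤ Fintype.card V := by
    have h0 : z ≠ 0 := by
      rintro rfl
      exact hz' (zero_mem _)
    obtain ⟨σ, hσ⟩ := Function.ne_iff.mp h0
    have h1 := (hz.1 σ hσ).2
    have := σ.card_le_univ
    omega
  obtain ⟨p, hp⟩ := Nat.exists_eq_add_of_le' hq
  have hne : Nonempty (MinimalGradedFreeResolution k V (Δ.StanleyReisnerRing k)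
      (Δ.stanleyReisnerGrading k)) :=
    nonempty_minimalGradedFreeResolution (Δ.stanleyReisnerIdeal k)
      Δ.homogeneousComponent_mem_stanleyReisnerIdeal Δ.coeff_zero_of_mem_stanleyReisnerIdeal
  obtain ⟨g, hg⟩ := Δ.exists_shift_eq_card hp.symm hne.some z hz hz'
  have hbetti : gradedBetti k V (Δ.stanleyReisnerGrading k) p (p + q) ≠ 0 := by
    rw [gradedBetti, dif_pos hne, MinimalGradedFreeResolution.betti]
    exact Finset.card_ne_zero_of_mem (Finset.mem_filter.mpr ⟨Finset.mem_univ g, hg⟩)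
  refine le_trans (le_of_eq (congrArg Real.toEReal ?_))
    (le_iSup_of_le p (le_iSup_of_le (p + q) (le_iSup_of_le hbetti le_rfl)))
  push_cast
  rw [add_sub_cancel_left]

end AbstractSimplicialComplex

end StanleyReisnerKoszul

/-! ### Restrictions and the Mayer-Vietoris argument -/

section MayerVietoris

namespace AbstractSimplicialComplex

variable (k : Type*) [Field k] {V : Type*} [LinearOrder V] [Fintype V]
  (Δ : AbstractSimplicialComplex V)

theorem boundary_boundary (c : Finset V → k) : boundary k V (boundary k V c) = 0 := by
  rw [boundary_eq_koszul, koszul_koszul]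

variable {k}

theorem boundary_apply (c : Finset V → k) (σ : Finset V) :
    boundary k V c σ = ∑ v ∈ σᶜ, lowerSign k v σ * c (insert v σ) := by
  simp [boundary_eq_koszul, koszul_apply]

variable {Δ} in
theorem boundary_mem_chains {i : ℤ} {c : Finset V → k} (hc : c ∈ Δ.chains k (i + 1)) :
    boundary k V c ∈ Δ.chains k i := by
  intro σ hσ
  rw [boundary_apply] at hσ
  obtain ⟨v, hv, h⟩ := Finset.exists_ne_zero_of_sum_ne_zero hσ
  obtain ⟨h1, h2⟩ := hc (insert v σ) (right_ne_zero_of_mul h)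
  refine ⟨h1.mono (Finset.subset_insert v σ), ?_⟩
  rw [Finset.card_insert_of_notMem (by simpa using hv)] at h2
  push_cast at h2
  omega

variable (k) in
/-- The chains of `Δ` that are supported on faces contained in `T`. -/
def chainsOn {V : Type*} (Δ : AbstractSimplicialComplex V) (T : Finset V) (i : ℤ) :
    Submodule k (Finset V → k) where
  carrier := {c | c ∈ Δ.chains k i ∧ ∀ σ, c σ ≠ 0 → σ ⊆ T}
  zero_mem' := ⟨zero_mem _, fun σ h => (h rfl).elim⟩
  add_mem' := by
    rintro a b ⟨ha, ha'⟩ ⟨hb, hb'⟩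
    refine ⟨add_mem ha hb, fun σ h => ?_⟩
    by_cases h0 : a σ = 0
    · exact hb' σ fun h1 => h (by simp [h0, h1])
    · exact ha' σ h0
  smul_mem' := by
    rintro r a ⟨ha, ha'⟩
    exact ⟨Submodule.smul_mem _ r ha, fun σ h => ha' σ fun h0 => h (by simp [h0])⟩

variable {Δ} in
theorem boundary_mem_chainsOn {T : Finset V} {i : ℤ} {c : Finset V → k}
    (hc : c ∈ Δ.chainsOn k T (i + 1)) : boundary k V c ∈ Δ.chainsOn k T i := by
  refine ⟨boundary_mem_chains hc.1, fun σ hσ => ?_⟩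
  rw [boundary_apply] at hσ
  obtain ⟨v, hv, h⟩ := Finset.exists_ne_zero_of_sum_ne_zero hσ
  exact (Finset.subset_insert v σ).trans (hc.2 _ (right_ne_zero_of_mul h))

theorem isFace_restrict_iff {V : Type*} (Δ : AbstractSimplicialComplex V) (T : Finset V)
    (σ : Finset {v // v ∈ T}) :
    (Δ.restrict T).IsFace σ ↔ Δ.IsFace (σ.map (Function.Embedding.subtype _)) := by
  unfold IsFace
  rw [Finset.map_eq_empty]
  rfl

variable (k) in
/-- Restriction of chains to the subsets of `T`. -/
def restrictChain {V : Type*} (T : Finset V) : (Finset V → k) →ₗ[k] (Finset {v // v ∈ T} → k) :=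
  LinearMap.funLeft k k fun σ => σ.map (Function.Embedding.subtype _)

theorem restrictChain_apply {V : Type*} (T : Finset V) (c : Finset V → k)
    (σ : Finset {v // v ∈ T}) :
    restrictChain k T c σ = c (σ.map (Function.Embedding.subtype _)) := rfl

variable (k) in
/-- Extension by zero of chains on the subsets of `T`. -/
def extendChain (T : Finset V) (c : Finset {v // v ∈ T} → k) (σ : Finset V) : k :=
  if σ ⊆ T then c (σ.subtype (· ∈ T)) else 0

theorem map_subtype_subset {V : Type*} (T : Finset V) (σ : Finset {v // v ∈ T}) :
    σ.map (Function.Embedding.subtype _) ⊆ T := by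
  intro v hv
  obtain ⟨w, -, rfl⟩ := Finset.mem_map.mp hv
  exact w.2

theorem restrictChain_extendChain {V : Type*} [LinearOrder V] (T : Finset V)
    (c : Finset {v // v ∈ T} → k) :
    restrictChain k T (extendChain k T c) = c := by
  ext σ
  rw [restrictChain_apply, extendChain, if_pos (map_subtype_subset T σ)]
  congr 1
  ext v
  simp

theorem restrictChain_mem_chains {V : Type*} {Δ : AbstractSimplicialComplex V} {T : Finset V}
    {i : ℤ} {c : Finset V → k}
    (hc : c ∈ Δ.chainsOn k T i) : restrictChain k T c ∈ (Δ.restrict T).chains k i := by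
  intro σ hσ
  obtain ⟨h1, h2⟩ := hc.1 _ hσ
  exact ⟨(Δ.isFace_restrict_iff T σ).mpr h1, by rwa [Finset.card_map] at h2⟩

theorem extendChain_mem_chainsOn {V : Type*} [LinearOrder V] {Δ : AbstractSimplicialComplex V}
    {T : Finset V} {i : ℤ} {c : Finset {v // v ∈ T} → k}
    (hc : c ∈ (Δ.restrict T).chains k i) : extendChain k T c ∈ Δ.chainsOn k T i := by
  have h (σ : Finset V) (hσ : extendChain k T c σ ≠ 0) :
      σ ⊆ T ∧ c (σ.subtype (· ∈ T)) ≠ 0 := by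
    unfold extendChain at hσ
    split_ifs at hσ with h
    · exact ⟨h, hσ⟩
    · exact (hσ rfl).elim
  refine ⟨fun σ hσ => ?_, fun σ hσ => (h σ hσ).1⟩
  obtain ⟨h1, h2⟩ := h σ hσ
  obtain ⟨h3, h4⟩ := hc _ h2
  have h5 : (σ.subtype (· ∈ T)).map (Function.Embedding.subtype _) = σ := by
    rw [Finset.subtype_map, Finset.filter_true_of_mem h1]
  rw [isFace_restrict_iff] at h3
  rw [← Finset.card_map (Function.Embedding.subtype _)] at h4
  rw [h5] at h3 h4
  exact ⟨h3, h4⟩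

/-- The order on `T` is induced, so the signs agree. The support condition is needed because a face
with one vertex outside `T` still has a boundary term inside `T`. -/
theorem restrictChain_boundary {T : Finset V} {c : Finset V → k}
    (hc : ∀ σ, c σ ≠ 0 → σ ⊆ T) :
    boundary k {v // v ∈ T} (restrictChain k T c) = restrictChain k T (boundary k V c) := by
  ext σ
  rw [restrictChain_apply, boundary_apply, boundary_apply]
  have h1 : σᶜ.map (Function.Embedding.subtype _) ⊆
      (σ.map (Function.Embedding.subtype (· ∈ T)))ᶜ := by
    intro v
    simp only [Finset.mem_map, Finset.mem_compl]
    rintro ⟨w, hw, rfl⟩ ⟨w', hw', h⟩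
    exact hw (Subtype.ext h ▸ hw')
  rw [← Finset.sum_subset h1, Finset.sum_map]
  · refine Finset.sum_congr rfl fun v _ => ?_
    rw [restrictChain_apply, Finset.map_insert]
    congr 1
    unfold lowerSign
    rw [Finset.filter_map, Finset.card_map]
    rfl
  · intro v hv hv'
    have : c (insert v (σ.map (Function.Embedding.subtype _))) = 0 := by
      by_contra h
      have hvT : v ∈ T := hc _ h (Finset.mem_insert_self _ _)
      refine hv' (Finset.mem_map.mpr ⟨⟨v, hvT⟩, ?_, rfl⟩)
      rw [Finset.mem_compl] at hv ⊢
      exact fun hw => hv (Finset.mem_map.mpr ⟨_, hw, rfl⟩)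
    rw [this, mul_zero]

theorem eq_of_restrictChain_eq {V : Type*} [LinearOrder V] {T : Finset V} {c c' : Finset V → k}
    (hc : ∀ σ, c σ ≠ 0 → σ ⊆ T) (hc' : ∀ σ, c' σ ≠ 0 → σ ⊆ T)
    (h : restrictChain k T c = restrictChain k T c') : c = c' := by
  ext σ
  by_cases hσ : σ ⊆ T
  · have h5 : (σ.subtype (· ∈ T)).map (Function.Embedding.subtype _) = σ := by
      rw [Finset.subtype_map, Finset.filter_true_of_mem hσ]
    have := congrFun h (σ.subtype (· ∈ T))
    rwa [restrictChain_apply, restrictChain_apply, h5] at this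
  · rw [show c σ = 0 by by_contra h0; exact hσ (hc σ h0),
      show c' σ = 0 by by_contra h0; exact hσ (hc' σ h0)]

theorem nontrivial_reducedHomology_iff {i : ℤ} :
    Nontrivial (Δ.ReducedHomology k i) ↔ ∃ z ∈ Δ.cycles k i, z ∉ Δ.boundaries k i := by
  rw [Submodule.Quotient.nontrivial_iff, Ne, Submodule.submoduleOf_eq_top,
    SetLike.not_le_iff_exists]

/-- The reduced homology of a restriction in terms of the chains of the whole complex. -/
theorem nontrivial_reducedHomology_restrict_iff (T : Finset V) {i : ℤ} :
    Nontrivial ((Δ.restrict T).ReducedHomology k i) ↔ ∃ z ∈ Δ.chainsOn k T i,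
      boundary k V z = 0 ∧ ∀ y ∈ Δ.chainsOn k T (i + 1), boundary k V y ≠ z := by
  rw [nontrivial_reducedHomology_iff]
  constructor
  · rintro ⟨z, ⟨hz1, hz2⟩, hz3⟩
    have hz := extendChain_mem_chainsOn hz1
    refine ⟨extendChain k T z, hz, ?_, fun y hy h => hz3 ⟨restrictChain k T y,
      restrictChain_mem_chains hy, ?_⟩⟩
    · rw [← sub_add_cancel i 1] at hz
      refine eq_of_restrictChain_eq (T := T) (boundary_mem_chainsOn hz).2 (fun σ h => (h rfl).elim)
        ?_
      rw [← restrictChain_boundary hz.2, restrictChain_extendChain, map_zero]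
      exact hz2
    · rw [restrictChain_boundary hy.2, h, restrictChain_extendChain]
  · rintro ⟨z, hz, hz1, hz2⟩
    refine ⟨restrictChain k T z, ⟨restrictChain_mem_chains hz, ?_⟩, ?_⟩
    · rw [SetLike.mem_coe, LinearMap.mem_ker, restrictChain_boundary hz.2, hz1, map_zero]
    · rintro ⟨y, hy, h⟩
      have hy' := extendChain_mem_chainsOn hy
      refine hz2 _ hy' (eq_of_restrictChain_eq (T := T) (boundary_mem_chainsOn hy').2 hz.2 ?_)
      rw [← restrictChain_boundary hy'.2, restrictChain_extendChain, h]

/-- If no face of a vertex minimal `h`-cycle meets both of two disjoint nonempty sets `A` and `B`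
of vertices, then the complement of `A ∪ B` carries homology in degree `h - 1`. -/
theorem IsVertexMinimalCycle.nontrivial_of_separated {h : ℤ} (hΔ : Δ.IsVertexMinimalCycle k h)
    {A B : Finset V} (hA : A.Nonempty) (hB : B.Nonempty)
    (hAB : ∀ σ, Δ.IsFace σ → Disjoint σ A ∨ Disjoint σ B) :
    Nontrivial ((Δ.restrict (A ∪ B)ᶜ).ReducedHomology k (h - 1)) := by
  have hvan (T : Finset V) (hT : T ≠ Finset.univ) (z) (hz : z ∈ Δ.chainsOn k T h)
      (hz0 : boundary k V z = 0) : ∃ y ∈ Δ.chainsOn k T (h + 1), boundary k V y = z := by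
    by_contra! hy
    exact hT ((hΔ T).mp ((Δ.nontrivial_reducedHomology_restrict_iff T).mpr ⟨z, hz, hz0, hy⟩))
  have hne (S : Finset V) (hS : S.Nonempty) : Sᶜ ≠ Finset.univ := by
    rw [Ne, Finset.compl_eq_univ_iff]
    exact hS.ne_empty
  obtain ⟨z, hz, hz0, hz1⟩ :=
    (Δ.nontrivial_reducedHomology_restrict_iff Finset.univ).mp ((hΔ Finset.univ).mpr rfl)
  -- The Mayer–Vietoris splitting: `z₁` avoids `A`, and by `hAB` the remainder avoids `B`.
  let z₁ : Finset V → k := fun σ => if Disjoint σ A then z σ else 0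
  have hz₁ : z₁ ∈ Δ.chainsOn k Aᶜ h := by
    have h1 (σ) (hσ : z₁ σ ≠ 0) : Disjoint σ A ∧ z σ ≠ 0 := by
      simp only [z₁] at hσ
      split_ifs at hσ with h
      · exact ⟨h, hσ⟩
      · exact (hσ rfl).elim
    exact ⟨fun σ hσ => hz.1 σ (h1 σ hσ).2,
      fun σ hσ => Finset.subset_compl_iff_disjoint_right.mpr (h1 σ hσ).1⟩
  have hz₂ : z - z₁ ∈ Δ.chainsOn k Bᶜ h := by
    refine ⟨sub_mem hz.1 hz₁.1, fun σ hσ => ?_⟩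
    have h1 : ¬ Disjoint σ A := by
      intro h1
      exact hσ (by simp [z₁, h1])
    have h2 : z σ ≠ 0 := by
      intro h2
      exact hσ (by simp [z₁, h2])
    exact Finset.subset_compl_iff_disjoint_right.mpr
      ((hAB σ (hz.1 σ h2).1).resolve_left h1)
  rw [nontrivial_reducedHomology_restrict_iff]
  have hmono {T T' : Finset V} (hT : T ⊆ T') {i : ℤ} {c : Finset V → k}
      (hc : c ∈ Δ.chainsOn k T i) : c ∈ Δ.chainsOn k T' i :=
    ⟨hc.1, fun σ hσ => (hc.2 σ hσ).trans hT⟩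
  have hw1 : boundary k V z₁ ∈ Δ.chainsOn k Aᶜ (h - 1) :=
    boundary_mem_chainsOn (by rwa [sub_add_cancel])
  have hw2 : boundary k V z₁ ∈ Δ.chainsOn k Bᶜ (h - 1) := by
    have h1 : boundary k V (z - z₁) ∈ Δ.chainsOn k Bᶜ (h - 1) :=
      boundary_mem_chainsOn (by rwa [sub_add_cancel])
    rw [map_sub, hz0, zero_sub] at h1
    exact neg_mem_iff.mp h1
  -- The image of `z` under the connecting map. If `y` bounds it away from `A ∪ B`, then `z₁ - y`
  -- and `z - z₁ + y` are cycles on proper vertex subsets, hence boundaries, and so is their sum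
  -- `z`.
  refine ⟨boundary k V z₁, ⟨hw1.1, fun σ hσ => ?_⟩, boundary_boundary k z₁, fun y hy hyz => ?_⟩
  · rw [Finset.compl_union]
    exact Finset.subset_inter (hw1.2 σ hσ) (hw2.2 σ hσ)
  · rw [sub_add_cancel] at hy
    obtain ⟨y₁, hy₁, h1⟩ := hvan Aᶜ (hne A hA) (z₁ - y)
      (sub_mem hz₁ (hmono (Finset.compl_subset_compl.mpr Finset.subset_union_left) hy))
      (by rw [map_sub, hyz, sub_self])
    obtain ⟨y₂, hy₂, h2⟩ := hvan Bᶜ (hne B hB) (z - z₁ + y)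
      (add_mem hz₂ (hmono (Finset.compl_subset_compl.mpr Finset.subset_union_right) hy))
      (by rw [map_add, map_sub, hyz, hz0, zero_sub, neg_add_cancel])
    refine hz1 (y₁ + y₂) (add_mem (hmono (Finset.subset_univ _) hy₁)
      (hmono (Finset.subset_univ _) hy₂)) ?_
    rw [map_add, h1, h2]
    abel

/-- The vertices of a disconnected restriction fall into two nonempty parts without a face meeting
both. -/
theorem exists_separation_of_isDisconnected {V : Type*} [LinearOrder V]
    (Δ : AbstractSimplicialComplex V) {T : Finset V} (hT : (Δ.restrict T).IsDisconnected) :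
    ∃ A B : Finset V, A.Nonempty ∧ B.Nonempty ∧ A ∪ B = T ∧
      ∀ σ, Δ.IsFace σ → Disjoint σ A ∨ Disjoint σ B := by
  classical
  unfold IsDisconnected SimpleGraph.Preconnected at hT
  push Not at hT
  obtain ⟨a, b, hab⟩ := hT
  let G := (Δ.restrict T).oneSkeleton
  -- The connected component of `a`, and all the other vertices of `T`. A face meeting both would
  -- contain an edge joining them.
  refine ⟨(Finset.univ.filter (G.Reachable a)).map (Function.Embedding.subtype _),
    (Finset.univ.filter fun v => ¬ G.Reachable a v).map (Function.Embedding.subtype _),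
    ⟨a, ?_⟩, ⟨b, ?_⟩, ?_, fun σ hσ => ?_⟩
  · simp [G]
  · simpa using hab
  · rw [← Finset.map_union, Finset.filter_union_filter_not_eq]
    ext v
    simp
  · by_contra! hd
    rw [Finset.not_disjoint_iff, Finset.not_disjoint_iff] at hd
    obtain ⟨⟨v, hvσ, hv⟩, ⟨w, hwσ, hw⟩⟩ := hd
    rw [Finset.mem_map] at hv hw
    obtain ⟨v, hv, rfl⟩ := hv
    obtain ⟨w, hw, rfl⟩ := hw
    rw [Finset.mem_filter] at hv hw
    have hvw : v ≠ w := by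
      rintro rfl
      exact hw.2 hv.2
    refine hw.2 (hv.2.trans (SimpleGraph.Adj.reachable ⟨hvw, ?_⟩))
    have h1 : Δ.IsFace {v.1, w.1} := hσ.mono (by
      intro u hu
      rw [Finset.mem_insert, Finset.mem_singleton] at hu
      rcases hu with rfl | rfl
      · exact hvσ
      · exact hwσ)
    rcases h1 with h1 | h1
    · exact (Finset.insert_ne_empty _ _ h1).elim
    · change Finset.map _ {v, w} ∈ Δ
      rw [Finset.map_insert, Finset.map_singleton]
      exact h1

end AbstractSimplicialComplex

end MayerVietoris

theorem theorem3p1 (k : Type*) [Field k] (n : ℕ) (Δ : AbstractSimplicialComplex (Fin n)) (h : ℤ)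
    (hΔ : Δ.IsVertexMinimalCycle k h) (T : Finset (Fin n)) (hT : (Δ.restrict T).IsDisconnected) :
    ((h : ℝ) : EReal) ≤ (Δ.restrict Tᶜ).stanleyReisnerRegularity k := by
  obtain ⟨A, B, hA, hB, rfl, hAB⟩ := Δ.exists_separation_of_isDisconnected hT
  have h1 := AbstractSimplicialComplex.IsVertexMinimalCycle.nontrivial_of_separated Δ hΔ hA hB hAB
  rw [AbstractSimplicialComplex.nontrivial_reducedHomology_iff] at h1
  obtain ⟨z, hz, hz'⟩ := h1
  -- Faces of dimension `h - 1` have `h` elements, so `h` is the natural number `q` of the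
  -- regularity bound.
  have hh : 0 ≤ h := by
    obtain ⟨σ, hσ⟩ : ∃ σ, z σ ≠ 0 := by
      by_contra! h0
      exact hz' (by rw [show z = 0 from funext h0]; exact zero_mem _)
    have := (hz.1 σ hσ).2
    omega
  obtain ⟨q, rfl⟩ := Int.eq_ofNat_of_zero_le hh
  exact_mod_cast AbstractSimplicialComplex.le_stanleyReisnerRegularity _ z hz hz'
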